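/- Let $T$ be a complete first-order theory in a language $L$ and let $\mathfrak{C}\models T$ be a monster model, i.e. a $\kappa$-saturated and strongly $\kappa$-homogeneous model for some uncountable cardinal $\kappa>|L|$. For a finite tuple $\bar a$ in $\mathfrak C$ and a set (or tuple) $D$ of elements of $\mathfrak C$ let $\binom{D}{\bar a}$ be the set of all tuples $\bar a'$ in $D$ with $\mathrm{tp}(\bar a'/\emptyset)=\mathrm{tp}(\bar a/\emptyset)$. A coloring $c:\binom{\mathfrak C}{\bar a}\to 2^n$ is externally definable if there are $L$-formulas $\varphi_i(\bar x,\bar y)$ and global types $p_i(\bar y)\in S_{\bar y}(\mathfrak C)$, $i<n$, such that $c(\bar a')(i)=1$ iff $\varphi_i(\bar a',\bar y)\in p_i$; it is an externally definable $(\Delta,q)$-coloring, where $\Delta$ is a set of $L$-formulas in the variables $\bar x,\bar y$ and $q\in S_{\bar y}(\emptyset)$, if moreover such $\varphi_i$ can be taken in $\Delta$ with $p_i\supseteq q$ for all $i<n$. * $T$ has EDEERP (the externally definable elementary embedding Ramsey property) if for all finite tuples $\bar a\subseteq\bar b$ in $\mathfrak C$, all $n<\omega$ and every externally definable coloring $c:\binom{\mathfrak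 C}{\bar a}\to 2^n$ there is $\bar b'\in\binom{\mathfrak C}{\bar b}$ such that $c$ is constant on $\binom{\bar b'}{\bar a}$. * $T$ has separately finite EDEERdeg (externally definable elementary embedding Ramsey degree) if for every finite tuple $\bar a$ in $\mathfrak C$, every finite set $\Delta$ of formulas in variables $\bar x,\bar y$ with $|\bar x|=|\bar a|$ and every $q\in S_{\bar y}(\emptyset)$ there is $l<\omega$ such that for every finite tuple $\bar b\supseteq\bar a$ in $\mathfrak C$, every $n<\omega$ and every externally definable $(\Delta,q)$-coloring $c:\binom{\mathfrak C}{\bar a}\to 2^n$ there is $\bar b'\in\binom{\mathfrak C}{\bar b}$ with $\#\,c\big[\binom{\bar b'}{\bar a}\big]\le l$. Let $\bar c$ be an enumeration of $\mathfrak C$ and let $X=S_{\bar c}(\mathfrak C)$ be the $\mathrm{Aut}(\mathfrak C)$-flow of all complete types over $\mathfrak C$ extending $\mathrm{tp}(\bar c/\emptyset)$. The Ellis semigroup $\mathrm{EL}(X)$ is the closure of $\mathrm{Aut}(\mathfrak C)$ in $X^X$ with the topology of pointwise convergence, with composition as the operation. The Ellis group of $T$ is $u\mathcal M$, for a minimal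 left ideal $\mathcal M$ of $\mathrm{EL}(X)$ and an idempotent $u\in\mathcal M$; the closed sets of its $\tau$-topology are those $B\subseteq u\mathcal M$ with $u\mathcal M\cap(u\circ B)=B$, where $u\circ B$ is the set of all limits of nets $(g_ib_i)_i$ with $g_i\in\mathrm{Aut}(\mathfrak C)$, $b_i\in B$ and $\lim_i g_i=u$. Let $\mathrm{Gal}_L(T)$ [respectively $\mathrm{Gal}_{KP}(T)$] be the quotient of $\mathrm{Aut}(\mathfrak C)$ by the normal subgroup of all automorphisms that, on each power $\mathfrak C^\alpha$ with $|\alpha|<\kappa$, preserve all classes of the intersection of all $\mathrm{Aut}(\mathfrak C)$-invariant [respectively $\emptyset$-type-definable] equivalence relations with fewer than $\kappa$ classes. Then: 1. If $T$ has EDEERP, then every minimal left ideal of $\mathrm{EL}(S_{\bar c}(\mathfrak C))$ is a singleton, so the Ellis group of $T$ (for every choice of $\mathcal M$ and $u$) is trivial, and the Lascar and Kim-Pillay Galois groups $\mathrm{Gal}_L(T)$ and $\mathrm{Gal}_{KP}(T)$ are trivial. 2. If $T$ has separately finite EDEERdeg, then (for every choice of $\mathcal M$ and $u$) the Ellis group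 $u\mathcal M$ of $T$ with its $\tau$-topology is a profinite group. -/

import Mathlib

open FirstOrder FirstOrder.Language Cardinal Filter Topology

universe u v w

/-! ## Topological dynamics: Ellis semigroups and Ellis groups -/

namespace EllisDynamics

section

variable (G : Type*) (X : Type*) [Group G] [MulAction G X] [TopologicalSpace X]

/-- The Ellis semigroup of the flow `(G, X)`: the closure of the set of all maps `x ↦ g • x`
in `X → X` with the topology of pointwise convergence. The semigroup operation is composition. -/
def EL : Set (X → X) := closure (Set.range fun (g : G) (x : X) => g • x)

/-- A (non-empty) left ideal of the Ellis semigroup. -/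
def IsLeftIdeal (I : Set (X → X)) : Prop :=
  I.Nonempty ∧ I ⊆ EL G X ∧ ∀ η ∈ EL G X, ∀ μ ∈ I, η ∘ μ ∈ I

/-- Minimal left ideals of the Ellis semigroup. -/
structure MinimalLeftIdeal where
  carrier : Set (X → X)
  isLeftIdeal : IsLeftIdeal G X carrier
  minimal : ∀ I : Set (X → X), IsLeftIdeal G X I → I ⊆ carrier → I = carrier

variable {X}

/-- `a ∘ B`: the set of all limits of nets `(gᵢ bᵢ)ᵢ` with `gᵢ ∈ G`, `bᵢ ∈ B` and `lim gᵢ = a`.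
Nets in `G × B` are given by proper filters on `G × (X → X)` that contain `{(g, b) | b ∈ B}`. -/
def circ (a : X → X) (B : Set (X → X)) : Set (X → X) :=
  {x | ∃ F : Filter (G × (X → X)), F.NeBot ∧ (∀ᶠ p in F, p.2 ∈ B) ∧
    Tendsto (fun p (y : X) => p.1 • y) F (𝓝 a) ∧
    Tendsto (fun p (y : X) => p.1 • p.2 y) F (𝓝 x)}

end

section

variable {G : Type*} {X : Type*} [Group G] [MulAction G X] [TopologicalSpace X]

theorem circ_mono (a : X → X) {B B' : Set (X → X)} (h : B ⊆ B') : circ G a B ⊆ circ G a B' := by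
  rintro x ⟨F, hF, hB, h1, h2⟩
  exact ⟨F, hF, hB.mono fun p hp => h hp, h1, h2⟩

theorem circ_empty (a : X → X) : circ G a ∅ = ∅ := by
  ext x
  simp only [Set.mem_empty_iff_false, iff_false]
  rintro ⟨F, hF, hB, -, -⟩
  obtain ⟨p, hp⟩ := hB.exists
  exact hp

theorem circ_union (a : X → X) (B B' : Set (X → X)) :
    circ G a (B ∪ B') ⊆ circ G a B ∪ circ G a B' := by
  rintro x ⟨F, hF, hB, h1, h2⟩
  by_cases h : ∃ᶠ p in F, p.2 ∈ B
  · left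
    refine ⟨F ⊓ 𝓟 {p | p.2 ∈ B}, Filter.frequently_mem_iff_neBot.1 h, ?_,
      h1.mono_left inf_le_left, h2.mono_left inf_le_left⟩
    exact Filter.mem_inf_of_right (Filter.mem_principal_self _)
  · right
    refine ⟨F, hF, ?_, h1, h2⟩
    filter_upwards [hB, Filter.not_frequently.1 h] with p hp hp'
    exact hp.resolve_left hp'

/-- The idempotents of a minimal left ideal. -/
def MinimalLeftIdeal.Idempotent (M : MinimalLeftIdeal G X) : Type _ :=
  {u : X → X // u ∈ M.carrier ∧ u ∘ u = u}

/-- The Ellis group `uM`, where `M` is a minimal left ideal and `u` is an idempotent in `M`. -/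
def EllisGroup (M : MinimalLeftIdeal G X) (u : M.Idempotent) : Type _ :=
  {η : X → X // ∃ μ ∈ M.carrier, η = u.1 ∘ μ}

variable {M : MinimalLeftIdeal G X} {u : M.Idempotent}

/-- The operation of the Ellis group is composition of functions. -/
instance : Mul (EllisGroup M u) where
  mul η θ := ⟨η.1 ∘ θ.1, by
    obtain ⟨-, hEL, hM⟩ := M.isLeftIdeal
    obtain ⟨_, μ, hμ, rfl⟩ := η
    obtain ⟨_, ν, hν, rfl⟩ := θ
    exact ⟨μ ∘ (u.1 ∘ ν), hM _ (hEL hμ) _ (hM _ (hEL u.2.1) _ hν), rfl⟩⟩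

/-- The closure operator of the `τ`-topology: `cl_τ(B) = uM ∩ (u ∘ B)`. -/
def clTau (B : Set (EllisGroup M u)) : Set (EllisGroup M u) :=
  {x | x.1 ∈ circ G u.1 ((fun η : EllisGroup M u => η.1) '' B)}

/-- The `τ`-topology on the Ellis group: the closed sets are those `B` with `cl_τ(B) ⊆ B`. -/
instance : TopologicalSpace (EllisGroup M u) :=
  TopologicalSpace.ofClosed {B | clTau B ⊆ B}
    (by
      intro x hx
      simp [clTau, circ_empty] at hx)
    (by
      intro A hA x hx B hB
      refine hA hB (circ_mono _ (Set.image_mono ?_) hx)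
      exact Set.sInter_subset_of_mem hB)
    (by
      intro A hA B hB x hx
      simp only [clTau, Set.image_union, Set.mem_ofPred_eq] at hx
      exact (circ_union _ _ _ hx).imp (fun h => hA h) (fun h => hB h))

end

/-- A set with a multiplication and a topology is profinite if it is isomorphic, algebraically and
topologically, to a profinite group. -/
def IsProfinite (A : Type w) [Mul A] [TopologicalSpace A] : Prop :=
  ∃ P : ProfiniteGrp.{w}, Nonempty (A ≃ₜ* P)

end EllisDynamics

/-! ## Model theory -/

namespace MonsterModel

section Aut

variable {L : FirstOrder.Language.{u, v}} {C : Type w} [L.Structure C]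

/-- The automorphism group of a structure. -/
instance : Group (C ≃[L] C) where
  mul f g := f.comp g
  one := FirstOrder.Language.Equiv.refl L C
  inv f := f.symm
  mul_assoc _ _ _ := rfl
  one_mul _ := rfl
  mul_one _ := rfl
  inv_mul_cancel f := by
    ext x
    exact f.toEquiv.symm_apply_apply x

theorem mul_apply (σ τ : C ≃[L] C) (x : C) : (σ * τ) x = σ (τ x) := rfl

theorem one_apply (x : C) : (1 : C ≃[L] C) x = x := rfl

theorem apply_inv (σ : C ≃[L] C) (x : C) : σ (σ⁻¹ x) = x := σ.toEquiv.apply_symm_apply x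

theorem inv_apply (σ : C ≃[L] C) (x : C) : σ⁻¹ (σ x) = x := σ.toEquiv.symm_apply_apply x

end Aut

section Types

variable (L : FirstOrder.Language.{u, v}) (C : Type w) [L.Structure C]

/-- Global types: complete types over `C` in variables `β`, that is, complete types of the
theory of `C` in the language with a constant for each element of `C`. -/
abbrev GlobalType (β : Type*) := (L.elementaryDiagram C).CompleteType β

variable {L C} {β : Type*}

/-- `φ(a, y) ∈ p(y)`, for an `L`-formula `φ(x, y)` without parameters and a tuple `a` in `C`. -/
def GlobalType.Contains (p : GlobalType L C β) {ι : Type*} (φ : L.Formula (ι ⊕ β))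
    (a : ι → C) : Prop :=
  Formula.equivSentence (L := L[[C]])
    (BoundedFormula.constantsVarsEquiv.symm (φ.relabel (Sum.map a id))) ∈ p

/-- The global type `p` extends the type `q` over the empty set. -/
def GlobalType.Extends (p : GlobalType L C β) {T : L.Theory} (q : T.CompleteType β) : Prop :=
  ∀ ψ ∈ q, (LHom.addConstants β (L.lhomWithConstants C)).onSentence ψ ∈ p

/-- The renaming of parameters `φ(y, a) ↦ φ(y, σ(a))`. -/
def renameParams (σ : C ≃[L] C) (β : Type*) : L[[C]][[β]] →ᴸ L[[C]][[β]] :=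
  LHom.addConstants β (L.lhomWithConstantsMap σ)

theorem renameParams_one : renameParams (1 : C ≃[L] C) β = LHom.id _ := by
  refine LHom.funext ?_ ?_ <;> funext n x
  · rcases x with (x | x) | x
    · rfl
    · cases n with
      | zero => rfl
      | succ n => exact isEmptyElim x
    · rfl
  · rcases x with (x | x) | x
    · rfl
    · exact isEmptyElim x
    · rfl

theorem renameParams_mul (σ τ : C ≃[L] C) :
    renameParams (σ * τ) β = (renameParams σ β).comp (renameParams τ β) := by
  refine LHom.funext ?_ ?_ <;> funext n x
  · rcases x with (x | x) | x
    · rfl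
    · cases n with
      | zero => rfl
      | succ n => exact isEmptyElim x
    · rfl
  · rcases x with (x | x) | x <;> rfl

theorem renameParams_comp_lhomWithConstants (σ : C ≃[L] C) :
    (renameParams σ β).comp (L[[C]].lhomWithConstants β) =
      (L[[C]].lhomWithConstants β).comp (L.lhomWithConstantsMap σ) := by
  refine LHom.funext ?_ ?_ <;> funext n x <;> rfl

theorem renameParams_comp_addConstants (σ : C ≃[L] C) :
    (renameParams σ β).comp (LHom.addConstants β (L.lhomWithConstants C)) =
      LHom.addConstants β (L.lhomWithConstants C) := by
  refine LHom.funext ?_ ?_ <;> funext n x <;> rcases x with x | x <;> rfl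

theorem onSentence_comp {L₁ L₂ L₃ : FirstOrder.Language} (f : L₂ →ᴸ L₃) (g : L₁ →ᴸ L₂)
    (φ : L₁.Sentence) : (f.comp g).onSentence φ = f.onSentence (g.onSentence φ) :=
  congrFun (LHom.comp_onBoundedFormula f g) φ

theorem onSentence_id {L₁ : FirstOrder.Language} (φ : L₁.Sentence) :
    (LHom.id L₁).onSentence φ = φ :=
  congrFun (LHom.id_onBoundedFormula) φ

theorem funMap_const (a : C) (x : Fin 0 → C) :
    Structure.funMap (L := L[[C]]) (M := C) (Sum.inr a : L[[C]].Functions 0) x = a :=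
  (withConstants_funMap_sumInr (L := L) (M := C) (α := C)).trans rfl

theorem realize_rename (σ : C ≃[L] C) (φ : L[[C]].Sentence) :
    C ⊨ (L.lhomWithConstantsMap σ).onSentence φ ↔ C ⊨ φ := by
  have hf : ∀ {n : ℕ} (f : L[[C]].Functions n) (x : Fin n → C),
      σ (Structure.funMap f x) =
        Structure.funMap ((L.lhomWithConstantsMap σ).onFunction f) (σ ∘ x) := by
    rintro n (f | f) x
    · exact σ.map_fun' f x
    · cases n with
      | zero =>
        let a : C := f
        exact (congrArg σ (funMap_const (L := L) a x)).trans
          (funMap_const (L := L) (σ a) (σ ∘ x)).symm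
      | succ n => exact isEmptyElim f
  have hr : ∀ {n : ℕ} (r : L[[C]].Relations n) (x : Fin n → C),
      Structure.RelMap ((L.lhomWithConstantsMap σ).onRelation r) (σ ∘ x) ↔
        Structure.RelMap r x := by
    rintro n (r | r) x
    · exact σ.map_rel' r x
    · exact isEmptyElim r
  let S₀ : L[[C]].Structure C := inferInstance
  let S : L[[C]].Structure C := (L.lhomWithConstantsMap σ).reduct C
  let e : @FirstOrder.Language.Equiv L[[C]] C C S₀ S :=
    @FirstOrder.Language.Equiv.mk L[[C]] C C S₀ S σ.toEquiv hf hr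
  have h1 : @Sentence.Realize L[[C]] C S₀ φ ↔ @Sentence.Realize L[[C]] C S φ :=
    @StrongHomClass.realize_sentence L[[C]] C C S₀ S _ _ _ e φ
  have h2 := @LHom.realize_onSentence _ _ C S S₀ (L.lhomWithConstantsMap σ)
    (@LHom.isExpansionOn_reduct _ _ (L.lhomWithConstantsMap σ) C S₀) φ
  exact h2.trans h1.symm

/-- The action of automorphisms on global types: `φ(y, a) ∈ σ(p)` iff `φ(y, σ⁻¹(a)) ∈ p`. -/
instance : MulAction (C ≃[L] C) (GlobalType L C β) where
  smul σ p :=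
    { toTheory := {ψ | (renameParams σ⁻¹ β).onSentence ψ ∈ p}
      subset' := by
        rintro _ ⟨ψ, hψ, rfl⟩
        refine p.subset ⟨(L.lhomWithConstantsMap ((σ⁻¹ : C ≃[L] C) : C → C)).onSentence ψ, ?_, ?_⟩
        · exact mem_completeTheory.2 ((realize_rename σ⁻¹ ψ).2 (mem_completeTheory.1 hψ))
        · rw [← onSentence_comp, ← onSentence_comp, renameParams_comp_lhomWithConstants]
      isMaximal' := by
        refine ⟨Theory.isSatisfiable_of_isSatisfiable_onTheory (renameParams σ⁻¹ β)
          (p.isMaximal.1.mono ?_), fun ψ => p.mem_or_not_mem ((renameParams σ⁻¹ β).onSentence ψ)⟩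
        rintro _ ⟨ψ, hψ, rfl⟩
        exact hψ }
  one_smul p := by
    refine SetLike.ext fun ψ => ?_
    change (renameParams (1 : C ≃[L] C)⁻¹ β).onSentence ψ ∈ p ↔ _
    rw [inv_one, renameParams_one, onSentence_id]
  mul_smul σ τ p := by
    refine SetLike.ext fun ψ => ?_
    change (renameParams (σ * τ)⁻¹ β).onSentence ψ ∈ p ↔
      (renameParams τ⁻¹ β).onSentence ((renameParams σ⁻¹ β).onSentence ψ) ∈ p
    rw [mul_inv_rev, renameParams_mul, onSentence_comp]

theorem extends_smul {T : L.Theory} {q : T.CompleteType β} (σ : C ≃[L] C) {p : GlobalType L C β}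
    (hp : p.Extends q) : (σ • p).Extends q := by
  intro ψ hψ
  change (renameParams σ⁻¹ β).onSentence _ ∈ p
  rw [← onSentence_comp, renameParams_comp_addConstants]
  exact hp ψ hψ

/-- `S_q(C)`: the flow of all global types that extend a type `q` over the empty set. -/
def typesExtending (C : Type w) [L.Structure C] {T : L.Theory} (q : T.CompleteType β) :
    SubMulAction (C ≃[L] C) (GlobalType L C β) where
  carrier := {p | p.Extends q}
  smul_mem' σ _ hp := extends_smul σ hp

/-- `S_c(C)`: the flow of all global types extending `tp(c)`, where `c` is the enumeration of `C` by
itself. -/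
def enumTypes (T : L.Theory) (C : Type w) [L.Structure C] [Nonempty C] [C ⊨ T] :
    SubMulAction (C ≃[L] C) (GlobalType L C C) :=
  typesExtending C (T.typeOf (id : C → C))

end Types

section Monster

variable (L : FirstOrder.Language.{u, v}) {C : Type w} [L.Structure C]

/-- Two tuples have the same type over the empty set. -/
def SameType {ι : Type*} (a b : ι → C) : Prop :=
  ∀ φ : L.Formula ι, φ.Realize a ↔ φ.Realize b

/-- A monster model of degree `κ`: a `κ`-saturated and strongly `κ`-homogeneous structure, where
`κ` is uncountable and greater than the cardinality of the language. -/
structure IsMonster (κ : Cardinal.{w}) (C : Type w) [L.Structure C] [Nonempty C] : Prop where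
  aleph0_lt : ℵ₀ < κ
  card_lt : Cardinal.lift.{w} L.card < Cardinal.lift.{max u v} κ
  saturated : ∀ A : Set C, #A < κ → ∀ p : (L[[A]].completeTheory C).CompleteType (Fin 1),
    p ∈ (L[[A]].completeTheory C).realizedTypes C (Fin 1)
  homogeneous : ∀ (ι : Type w), #ι < κ → ∀ a b : ι → C, SameType L a b →
    ∃ σ : C ≃[L] C, ∀ i, σ (a i) = b i

/-! ### Colorings and Ramsey properties -/

/-- The set of all realizations in `D` of the type of the tuple `a` over the empty set. -/
def copies (D : Set C) {k : ℕ} (a : Fin k → C) : Set (Fin k → C) :=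
  {a' | (∀ i, a' i ∈ D) ∧ SameType L a' a}

/-- A coloring with `2 ^ n` colors of all realizations of `tp(a)` in `C`. -/
abbrev Coloring {k : ℕ} (a : Fin k → C) (n : ℕ) : Type w :=
  copies L Set.univ a → (Fin n → Bool)

variable {L}

/-- The set of colors that a coloring takes on the realizations of `tp(a)` in the tuple `b`. -/
def Coloring.colorsIn {k n : ℕ} {a : Fin k → C} (c : Coloring L a n) {m : ℕ} (b : Fin m → C) :
    Set (Fin n → Bool) :=
  c '' {a' | a'.1 ∈ copies L (Set.range b) a}

/-- The coloring `c` is the externally definable coloring given by the formulas `φᵢ(x, y)` and the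
global types `pᵢ(y)`. -/
def Coloring.IsGivenBy {k n : ℕ} {a : Fin k → C} (c : Coloring L a n) {β : Type*}
    (φ : Fin n → L.Formula (Fin k ⊕ β)) (p : Fin n → GlobalType L C β) : Prop :=
  ∀ a' i, c a' i = true ↔ (p i).Contains (φ i) a'.1

/-- Externally definable colorings. -/
def Coloring.IsExternallyDefinable {k n : ℕ} {a : Fin k → C} (c : Coloring L a n) : Prop :=
  ∃ (β : Type w) (φ : Fin n → L.Formula (Fin k ⊕ β)) (p : Fin n → GlobalType L C β),
    c.IsGivenBy φ p

/-- Externally definable `(Δ, q)`-colorings. -/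
def Coloring.IsExternallyDefinableBy {k n : ℕ} {a : Fin k → C} (c : Coloring L a n) {β : Type*}
    {T : L.Theory} (Δ : Set (L.Formula (Fin k ⊕ β))) (q : T.CompleteType β) : Prop :=
  ∃ (φ : Fin n → L.Formula (Fin k ⊕ β)) (p : Fin n → GlobalType L C β),
    (∀ i, φ i ∈ Δ) ∧ (∀ i, (p i).Extends q) ∧ c.IsGivenBy φ p

variable (L C)

/-- The externally definable elementary embedding Ramsey property. -/
def HasEDEERP : Prop :=
  ∀ (k m : ℕ) (a : Fin k → C) (b : Fin m → C), Set.range a ⊆ Set.range b →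
    ∀ (n : ℕ) (c : Coloring L a n), c.IsExternallyDefinable →
      ∃ b' ∈ copies L Set.univ b, ∃ ε : Fin n → Bool, c.colorsIn b' = {ε}

variable {L}

/-- Separately finite externally definable elementary embedding Ramsey degree. -/
def HasSepFinEDEERdeg (T : L.Theory) : Prop :=
  ∀ (k : ℕ) (a : Fin k → C) (β : Type w) (Δ : Set (L.Formula (Fin k ⊕ β))), Δ.Finite →
    ∀ q : T.CompleteType β, ∃ l : ℕ, ∀ (m : ℕ) (b : Fin m → C), Set.range a ⊆ Set.range b →
      ∀ (n : ℕ) (c : Coloring L a n), c.IsExternallyDefinableBy Δ q →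
        ∃ b' ∈ copies L Set.univ b, (c.colorsIn b').encard ≤ l

/-! ### Galois groups -/

variable {C}

/-- Invariance of an equivalence relation under all automorphisms. -/
def IsInvariant (L : FirstOrder.Language.{u, v}) [L.Structure C] {α : Type w}
    (E : Setoid (α → C)) : Prop :=
  ∀ (σ : C ≃[L] C) (a b : α → C), E a b → E (σ ∘ a) (σ ∘ b)

/-- Type-definability over the empty set of an equivalence relation. -/
def IsTypeDefinable (L : FirstOrder.Language.{u, v}) [L.Structure C] {α : Type w}
    (E : Setoid (α → C)) : Prop :=
  ∃ Γ : Set (L.Formula (α ⊕ α)), ∀ a b : α → C, E a b ↔ ∀ φ ∈ Γ, φ.Realize (Sum.elim a b)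

theorem IsTypeDefinable.isInvariant {α : Type w} {E : Setoid (α → C)}
    (h : IsTypeDefinable L E) : IsInvariant L E := by
  obtain ⟨Γ, hΓ⟩ := h
  intro σ a b hab
  rw [hΓ] at hab ⊢
  intro φ hφ
  have h := (StrongHomClass.realize_formula σ φ (v := Sum.elim a b)).2 (hab φ hφ)
  rwa [Sum.comp_elim] at h

/-- An equivalence relation is bounded if it has fewer than `κ` classes. -/
def IsBounded (κ : Cardinal.{w}) {α : Type w} (E : Setoid (α → C)) : Prop :=
  #(Quotient E) < κ

variable (L)

/-- Equality of Lascar strong types: the intersection of all bounded invariant equivalence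
relations. -/
def lascarEquiv (κ : Cardinal.{w}) (C : Type w) [L.Structure C] (α : Type w) : Setoid (α → C) :=
  sInf {E | IsInvariant L E ∧ IsBounded κ E}

/-- Equality of Kim-Pillay strong types: the intersection of all bounded equivalence relations that
are type-definable over the empty set. -/
def kimPillayEquiv (κ : Cardinal.{w}) (C : Type w) [L.Structure C] (α : Type w) :
    Setoid (α → C) :=
  sInf {E | IsTypeDefinable L E ∧ IsBounded κ E}

variable {L}

theorem isInvariant_sInf {α : Type w} {S : Set (Setoid (α → C))}
    (hS : ∀ E ∈ S, IsInvariant L E) : IsInvariant L (sInf S) := by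
  intro σ a b hab
  rw [Setoid.sInf_iff] at hab ⊢
  exact fun E hE => hS E hE σ a b (hab E hE)

variable (L)

/-- The group of all automorphisms that preserve each class of the given equivalence relations on
all small powers of `C`. -/
def strongAut (κ : Cardinal.{w}) (r : ∀ α : Type w, Setoid (α → C)) : Subgroup (C ≃[L] C) where
  carrier := {σ | ∀ α : Type w, #α < κ → ∀ a : α → C, r α a (σ ∘ a)}
  one_mem' α _ a := (r α).refl a
  mul_mem' {σ τ} hσ hτ α hα a := (r α).trans (hτ α hα a) (hσ α hα (τ ∘ a))
  inv_mem' {σ} hσ α hα a := by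
    have h := (r α).symm (hσ α hα ((σ⁻¹ : C ≃[L] C) ∘ a))
    have e : σ ∘ ((σ⁻¹ : C ≃[L] C) ∘ a) = a := funext fun i => apply_inv σ (a i)
    rwa [e] at h

theorem strongAut_normal (κ : Cardinal.{w}) (r : ∀ α : Type w, Setoid (α → C))
    (hr : ∀ α, IsInvariant L (r α)) : (strongAut L κ r).Normal where
  conj_mem σ hσ τ α hα a := by
    have h := hr α τ _ _ (hσ α hα ((τ⁻¹ : C ≃[L] C) ∘ a))
    have e : τ ∘ ((τ⁻¹ : C ≃[L] C) ∘ a) = a := funext fun i => apply_inv τ (a i)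
    rwa [e] at h

variable (C)

/-- The group of Lascar strong automorphisms. -/
def autfL (κ : Cardinal.{w}) : Subgroup (C ≃[L] C) := strongAut L κ (lascarEquiv L κ C)

/-- The group of Kim-Pillay strong automorphisms. -/
def autfKP (κ : Cardinal.{w}) : Subgroup (C ≃[L] C) := strongAut L κ (kimPillayEquiv L κ C)

instance (κ : Cardinal.{w}) : (autfL L C κ).Normal :=
  strongAut_normal L κ _ fun _ => isInvariant_sInf fun _ h => h.1

instance (κ : Cardinal.{w}) : (autfKP L C κ).Normal :=
  strongAut_normal L κ _ fun _ => isInvariant_sInf fun _ h => h.1.isInvariant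

/-- The Lascar Galois group. -/
abbrev GalL (κ : Cardinal.{w}) : Type _ := (C ≃[L] C) ⧸ autfL L C κ

/-- The Kim-Pillay Galois group. -/
abbrev GalKP (κ : Cardinal.{w}) : Type _ := (C ≃[L] C) ⧸ autfKP L C κ

end Monster

end MonsterModel

-- Both parts combine compactness of the Ellis semigroup EL with an ideal argument. A Ramsey
-- hypothesis concerns one finite tuple `b` and finitely many global types at a time. Writing the
-- good copy of `b` as `σ ∘ b` turns it into closed conditions on finitely many values of the map
-- `σ⁻¹ • ·`, so some `η ∈ EL` meets all such conditions at once. The properties of `η` obtained in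
-- this way define two-sided ideals, and these contain every minimal left ideal M
-- (`MinimalLeftIdeal.subset_of_twoSided`).
--
-- Under EDEERP, every `η p` with `η ∈ M` treats all realizations of each tp(a) alike, so it is an
-- Aut(C)-invariant type. Hence `EL ∘ η = {η}`, and M is a singleton. The existence of an invariant
-- type in `S_c(C)` then forces every bounded invariant equivalence relation to relate `a` and `τ ∘
-- a` (`rel_of_invariant_type`), which makes the Galois groups trivial.
--
-- Under finite degrees, each pair (a, φ) gives a factor `traceMap` of the flow on which some `η ∈
-- EL` has finite image (`HasSepFinEDEERdeg.exists_finite_range`). So uM has a finite quotient with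
-- τ-closed classes for each pair. These quotients separate points, and τ-compactness embeds uM as a
-- closed subgroup of a product of finite groups (`EllisDynamics.isProfinite_ellisGroup`).

universe w'

namespace EllisDynamics

/-! ### Ellis semigroups and minimal left ideals. -/

section Semigroup

variable {G : Type*} {X : Type*} [Group G] [MulAction G X] [TopologicalSpace X]

theorem isClosed_EL : IsClosed (EL G X) := isClosed_closure

theorem smul_mem_EL (g : G) : (fun x : X => g • x) ∈ EL G X := subset_closure ⟨g, rfl⟩

theorem continuous_comp_right (θ : X → X) : Continuous fun η : X → X => η ∘ θ :=
  continuous_pi fun x => continuous_apply (θ x)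

/-- A closed property of `η` that holds for all `g ∈ G` holds on the Ellis semigroup. -/
theorem EL_induction {P : Set (X → X)} (hP : IsClosed P) (h : ∀ g : G, (fun x => g • x) ∈ P)
    {η : X → X} (hη : η ∈ EL G X) : η ∈ P :=
  closure_minimal (Set.range_subset_iff.2 h) hP hη

theorem comp_mem_EL [ContinuousConstSMul G X] {η θ : X → X} (hη : η ∈ EL G X)
    (hθ : θ ∈ EL G X) : η ∘ θ ∈ EL G X := by
  refine EL_induction (P := {η | η ∘ θ ∈ EL G X})
    (isClosed_EL.preimage (continuous_comp_right θ)) (fun g => ?_) hη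
  have hc : Continuous fun θ : X → X => (fun x => g • θ x) :=
    continuous_pi fun x => (continuous_const_smul g).comp (continuous_apply x)
  refine EL_induction (P := {θ | (fun x => g • θ x) ∈ EL G X})
    (isClosed_EL.preimage hc) (fun g' => ?_) hθ
  have := smul_mem_EL (X := X) (g * g')
  simp only [mul_smul] at this
  exact this

theorem id_mem_EL : (id : X → X) ∈ EL G X := by
  have := smul_mem_EL (X := X) (1 : G)
  simp only [one_smul] at this
  exact this

theorem isLeftIdeal_image_comp [ContinuousConstSMul G X] {μ : X → X} (hμ : μ ∈ EL G X) :
    IsLeftIdeal G X ((fun η : X → X => η ∘ μ) '' EL G X) := by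
  refine ⟨⟨_, _, id_mem_EL, rfl⟩, ?_, ?_⟩
  · rintro _ ⟨η, hη, rfl⟩
    exact comp_mem_EL hη hμ
  · rintro θ hθ _ ⟨η, hη, rfl⟩
    exact ⟨θ ∘ η, comp_mem_EL hθ hη, rfl⟩

theorem IsLeftIdeal.image_comp_subset {I : Set (X → X)} (hI : IsLeftIdeal G X I) {μ : X → X}
    (hμ : μ ∈ I) : (fun η : X → X => η ∘ μ) '' EL G X ⊆ I := by
  rintro _ ⟨η, hη, rfl⟩
  exact hI.2.2 η hη μ hμ

theorem isClosed_image_comp [CompactSpace X] [T2Space X] (μ : X → X) :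
    IsClosed ((fun η : X → X => η ∘ μ) '' EL G X) :=
  (isClosed_EL.isCompact.image (continuous_comp_right μ)).isClosed

-- Zorn's lemma is applied to closed left ideals, where compactness keeps intersections of chains
-- nonempty. A minimal closed one is minimal among all left ideals, because a left ideal I contains
-- the closed left ideal `EL ∘ μ` for each `μ ∈ I`.
variable (G X) in
theorem exists_minimalLeftIdeal [CompactSpace X] [T2Space X] [ContinuousConstSMul G X] :
    Nonempty (MinimalLeftIdeal G X) := by
  obtain ⟨M, hM⟩ : ∃ M, Minimal (· ∈ {I | IsLeftIdeal G X I ∧ IsClosed I}) M := by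
    refine zorn_superset _ fun c hc hchain => ?_
    rcases c.eq_empty_or_nonempty with rfl | hne
    · exact ⟨EL G X, ⟨⟨⟨_, id_mem_EL⟩, subset_rfl, fun η hη μ hμ => comp_mem_EL hη hμ⟩,
        isClosed_EL⟩, by simp⟩
    refine ⟨⋂₀ c, ⟨⟨?_, ?_, ?_⟩, isClosed_sInter fun I hI => (hc hI).2⟩,
      fun I hI => Set.sInter_subset_of_mem hI⟩
    · have := hne.to_subtype
      refine IsCompact.nonempty_sInter_of_directed_nonempty_isCompact_isClosed
        (show IsChain (· ⊇ ·) c from hchain.symm).directedOn (fun I hI => (hc hI).1.1)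
        (fun I hI => (hc hI).2.isCompact) (fun I hI => (hc hI).2)
    · obtain ⟨I, hI⟩ := hne
      exact (Set.sInter_subset_of_mem hI).trans (hc hI).1.2.1
    · intro η hη μ hμ I hI
      exact (hc hI).1.2.2 η hη μ (hμ I hI)
  refine ⟨⟨M, hM.prop.1, fun I hI hIM => hIM.antisymm ?_⟩⟩
  obtain ⟨μ, hμ⟩ := hI.1
  refine Set.Subset.trans ?_ (hI.image_comp_subset hμ)
  exact hM.le_of_le ⟨isLeftIdeal_image_comp (hI.2.1 hμ), isClosed_image_comp μ⟩
    ((hI.image_comp_subset hμ).trans hIM)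

namespace MinimalLeftIdeal

variable (M : MinimalLeftIdeal G X)

variable {M} in
theorem mem_EL {μ : X → X} (hμ : μ ∈ M.carrier) : μ ∈ EL G X := M.isLeftIdeal.2.1 hμ

variable {M} in
theorem comp_mem {η μ : X → X} (hη : η ∈ EL G X) (hμ : μ ∈ M.carrier) : η ∘ μ ∈ M.carrier :=
  M.isLeftIdeal.2.2 η hη μ hμ

theorem image_comp_eq [ContinuousConstSMul G X] {μ : X → X} (hμ : μ ∈ M.carrier) :
    (fun η : X → X => η ∘ μ) '' EL G X = M.carrier :=
  M.minimal _ (isLeftIdeal_image_comp (mem_EL hμ)) (M.isLeftIdeal.image_comp_subset hμ)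

theorem isClosed_carrier [CompactSpace X] [T2Space X] [ContinuousConstSMul G X] :
    IsClosed M.carrier := by
  obtain ⟨μ, hμ⟩ := M.isLeftIdeal.1
  exact M.image_comp_eq hμ ▸ isClosed_image_comp μ

theorem comp_idempotent [ContinuousConstSMul G X] (u : M.Idempotent) {η : X → X}
    (hη : η ∈ M.carrier) : η ∘ u.1 = η := by
  rw [← M.image_comp_eq u.2.1] at hη
  obtain ⟨θ, -, rfl⟩ := hη
  exact congrArg (θ ∘ ·) u.2.2

/-- Minimal left ideals are contained in all two-sided ideals. -/
theorem subset_of_twoSided (I : Set (X → X)) (hne : I.Nonempty)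
    (hEL : I ⊆ EL G X) (hl : ∀ η ∈ EL G X, ∀ μ ∈ I, η ∘ μ ∈ I)
    (hr : ∀ η ∈ EL G X, ∀ μ ∈ I, μ ∘ η ∈ I) : M.carrier ⊆ I := by
  obtain ⟨τ, hτ⟩ := hne
  obtain ⟨μ, hμ⟩ := M.isLeftIdeal.1
  -- The element `τ ∘ μ` lies in M because M absorbs on the left, and in I because I absorbs on the
  -- right.
  have h := M.minimal (M.carrier ∩ I)
    ⟨⟨τ ∘ μ, comp_mem (hEL hτ) hμ, hr μ (mem_EL hμ) τ hτ⟩,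
      fun η hη => mem_EL hη.1,
      fun η hη μ hμ => ⟨comp_mem hη hμ.1, hl η hη μ hμ.2⟩⟩ Set.inter_subset_left
  exact h ▸ Set.inter_subset_right

end MinimalLeftIdeal

end Semigroup

/-! ### The group uM and compactness of its τ-topology. -/

section EllisGroup

variable {G : Type*} {X : Type*} [Group G] [MulAction G X] [TopologicalSpace X]
variable {M : MinimalLeftIdeal G X} {u : M.Idempotent}

namespace EllisGroup

@[ext]
theorem ext {η θ : EllisGroup M u} (h : η.1 = θ.1) : η = θ := Subtype.ext h

theorem val_mem (η : EllisGroup M u) : η.1 ∈ M.carrier := by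
  obtain ⟨μ, hμ, h⟩ := η.2
  rw [h]
  exact MinimalLeftIdeal.comp_mem (MinimalLeftIdeal.mem_EL u.2.1) hμ

theorem val_mem_EL (η : EllisGroup M u) : η.1 ∈ EL G X := MinimalLeftIdeal.mem_EL η.val_mem

theorem idempotent_comp_val (η : EllisGroup M u) : u.1 ∘ η.1 = η.1 := by
  obtain ⟨_, μ, hμ, rfl⟩ := η
  exact congrArg (· ∘ μ) u.2.2

theorem val_comp_idempotent [ContinuousConstSMul G X] (η : EllisGroup M u) : η.1 ∘ u.1 = η.1 :=
  M.comp_idempotent u η.val_mem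

/-- The element `u ∘ μ` of the Ellis group. -/
def mk {μ : X → X} (hμ : μ ∈ M.carrier) : EllisGroup M u := ⟨u.1 ∘ μ, μ, hμ, rfl⟩

instance : One (EllisGroup M u) := ⟨mk u.2.1⟩

theorem val_one : (1 : EllisGroup M u).1 = u.1 := u.2.2

/-- Since `EL ∘ η` is all of M, there is `ν` with `ν ∘ η = u`. Then `u ∘ ν ∘ u` is a left inverse,
because `u ∘ η = η`. -/
theorem exists_mul_eq_one [ContinuousConstSMul G X] (η : EllisGroup M u) :
    ∃ θ : EllisGroup M u, θ * η = 1 := by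
  obtain ⟨ν, hν, h⟩ := (M.image_comp_eq η.val_mem).symm.subset u.2.1
  refine ⟨mk (MinimalLeftIdeal.comp_mem hν u.2.1), ext ?_⟩
  change u.1 ∘ (ν ∘ u.1) ∘ η.1 = u.1 ∘ u.1
  rw [Function.comp_assoc, idempotent_comp_val]
  exact congrArg (u.1 ∘ ·) h

noncomputable instance [ContinuousConstSMul G X] : Group (EllisGroup M u) :=
  { (inferInstance : Mul (EllisGroup M u)), (inferInstance : One (EllisGroup M u)) with
    mul_assoc := fun _ _ _ => rfl
    one_mul := fun η => ext ((congrArg (· ∘ η.1) val_one).trans η.idempotent_comp_val)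
    mul_one := fun η => ext ((congrArg (η.1 ∘ ·) val_one).trans η.val_comp_idempotent)
    inv := fun η => η.exists_mul_eq_one.choose
    inv_mul_cancel := fun η => η.exists_mul_eq_one.choose_spec }

theorem isClosed_iff {B : Set (EllisGroup M u)} : IsClosed B ↔ clTau B ⊆ B :=
  isOpen_compl_iff.symm.trans (iff_of_eq (congrArg (fun s => clTau s ⊆ s) (compl_compl B)))

end EllisGroup

/-- The pair `(η, η ∘ f)` lies in the closure of the pairs (g, g b): this is a closed condition on
`η`, and for `η = g` it follows from continuity of `b ↦ g b`. Pulling back the neighbourhoods of the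
pair yields the net. -/
theorem comp_mem_circ [ContinuousConstSMul G X] {η f : X → X} (hη : η ∈ EL G X)
    {B : Set (X → X)} (hf : f ∈ closure B) : η ∘ f ∈ circ G η B := by
  let Φ : G × (X → X) → (X → X) × (X → X) := fun p => (fun y => p.1 • y, fun y => p.1 • p.2 y)
  have h : (η, η ∘ f) ∈ closure (Φ '' {p | p.2 ∈ B}) := by
    have hc : Continuous fun η : X → X => (η, η ∘ f) :=
      continuous_id.prodMk (continuous_comp_right f)
    refine EL_induction (P := {η | (η, η ∘ f) ∈ closure (Φ '' {p | p.2 ∈ B})})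
      (isClosed_closure.preimage hc) (fun g => ?_) hη
    have hg' : Continuous fun (b : X → X) (y : X) => g • b y :=
      continuous_pi fun y => (continuous_apply y).const_smul g
    have hg : Continuous fun b : X → X => Φ (g, b) :=
      (continuous_const (y := fun y : X => g • y)).prodMk hg'
    exact map_mem_closure (f := fun b => Φ (g, b)) hg hf fun b hb => ⟨(g, b), hb, rfl⟩
  refine ⟨comap Φ (𝓝 (η, η ∘ f)) ⊓ 𝓟 {p | p.2 ∈ B}, ?_, ?_, ?_, ?_⟩
  · rw [← map_neBot_iff Φ, Filter.push_pull', map_principal]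
    exact mem_closure_iff_clusterPt.1 h
  · exact mem_inf_of_right (mem_principal_self _)
  · have := (tendsto_comap (f := Φ) (x := 𝓝 (η, η ∘ f))).mono_left
      (inf_le_left (b := 𝓟 {p | p.2 ∈ B}))
    exact (continuous_fst.tendsto (η, η ∘ f)).comp this
  · have := (tendsto_comap (f := Φ) (x := 𝓝 (η, η ∘ f))).mono_left
      (inf_le_left (b := 𝓟 {p | p.2 ∈ B}))
    exact (continuous_snd.tendsto (η, η ∘ f)).comp this

/-- The `τ`-topology is quasi-compact. -/
instance [CompactSpace X] [T2Space X] [ContinuousConstSMul G X] :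
    CompactSpace (EllisGroup M u) := by
  refine ⟨isCompact_iff_ultrafilter_le_nhds.2 fun U _ => ?_⟩
  have hU : M.carrier ∈ U.map (fun η : EllisGroup M u => η.1) :=
    Filter.mem_map.2 (Filter.univ_mem' EllisGroup.val_mem)
  obtain ⟨f, hf, hUf⟩ := isCompact_iff_ultrafilter_le_nhds.1 M.isClosed_carrier.isCompact
    (U.map fun η : EllisGroup M u => η.1) (le_principal_iff.2 hU)
  -- The τ-limit is `u ∘ f`, where `f` is the pointwise limit: a τ-closed set in the ultrafilter has
  -- `f` in its pointwise closure, so it contains `u ∘ f` by `comp_mem_circ`.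
  refine ⟨EllisGroup.mk hf, trivial, le_nhds_iff.2 fun O hO hOo => ?_⟩
  by_contra hcon
  have hB : Oᶜ ∈ U := Ultrafilter.compl_mem_iff_notMem.2 hcon
  refine EllisGroup.isClosed_iff.1 hOo.isClosed_compl ?_ hO
  refine comp_mem_circ (MinimalLeftIdeal.mem_EL u.2.1) (mem_closure_iff_ultrafilter.2
    ⟨U.map fun η : EllisGroup M u => η.1, ?_, hUf⟩)
  exact Filter.image_mem_map hB

end EllisGroup

/-! ### A criterion for the Ellis group to be profinite. -/

section Profinite

variable {G : Type*} {X : Type*} [Group G] [MulAction G X] [TopologicalSpace X]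

/-- A map whose fibres are permuted by `G` is compatible with all elements of the Ellis
semigroup. -/
theorem EL_compat {Y : Type*} [TopologicalSpace Y] [T2Space Y] {r : X → Y} (hr : Continuous r)
    (hG : ∀ (g : G) p p', r p = r p' → r (g • p) = r (g • p')) {η : X → X} (hη : η ∈ EL G X)
    {p p' : X} (h : r p = r p') : r (η p) = r (η p') :=
  EL_induction (P := {η | r (η p) = r (η p')})
    (isClosed_eq (hr.comp (continuous_apply p)) (hr.comp (continuous_apply p')))
    (fun g => hG g p p' h) hη

variable (M : MinimalLeftIdeal G X) (u : M.Idempotent)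

/-- The congruence on the Ellis group that identifies elements with the same composite with `r`. -/
def factorCon {Y : Type*} [TopologicalSpace Y] [T2Space Y] {r : X → Y} (hr : Continuous r)
    (hG : ∀ (g : G) p p', r p = r p' → r (g • p) = r (g • p')) : Con (EllisGroup M u) where
  r η θ := r ∘ η.1 = r ∘ θ.1
  iseqv := ⟨fun _ => rfl, Eq.symm, Eq.trans⟩
  mul' {η η' θ θ'} h h' := by
    funext p
    exact (EL_compat hr hG η.val_mem_EL (congrFun h' p)).trans (congrFun h (θ'.1 p))

variable {M u}

/-- Along a net with g → u and g b → x, the values r(g b p) and r(g θ p) agree. The former tend to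
r(x p), the latter to r(u θ p) = r(θ p). -/
theorem isClosed_factorCon_class {Y : Type*} [TopologicalSpace Y] [T2Space Y] {r : X → Y}
    (hr : Continuous r) (hG : ∀ (g : G) p p', r p = r p' → r (g • p) = r (g • p'))
    (θ : EllisGroup M u) : IsClosed {η : EllisGroup M u | factorCon M u hr hG η θ} := by
  rw [EllisGroup.isClosed_iff]
  rintro x ⟨F, hF, hB, h1, h2⟩
  change r ∘ x.1 = r ∘ θ.1
  funext p
  have t1 := (hr.tendsto _).comp (((continuous_apply p).tendsto _).comp h2)
  have t2 := (hr.tendsto _).comp (((continuous_apply (θ.1 p)).tendsto _).comp h1)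
  have e : u.1 (θ.1 p) = θ.1 p := congrFun θ.idempotent_comp_val p
  rw [e] at t2
  refine tendsto_nhds_unique t1 (t2.congr' ?_)
  filter_upwards [hB]
  rintro ⟨g, _⟩ ⟨b, hb, rfl⟩
  exact (hG g _ _ (congrFun hb p)).symm

/-- The `η` for which `r ∘ η` has finite range form a two-sided ideal, so `r ∘ u` has finite range.
As `u ∘ η = η = η ∘ u`, each `η` in uM induces a self-map of this finite range, and that self-map
determines `r ∘ η`. -/
theorem finite_factorCon_quotient [ContinuousConstSMul G X] {Y : Type*} [TopologicalSpace Y] [T2Space Y] {r : X → Y}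
    (hr : Continuous r) (hG : ∀ (g : G) p p', r p = r p' → r (g • p) = r (g • p'))
    (hfin : ∃ η ∈ EL G X, (Set.range (r ∘ η)).Finite) :
    Finite (factorCon M u hr hG).Quotient := by
  have hM : M.carrier ⊆ {η ∈ EL G X | (Set.range (r ∘ η)).Finite} := by
    refine M.subset_of_twoSided _ hfin (fun η hη => hη.1) ?_ ?_
    · rintro η hη μ ⟨hμ, hf⟩
      refine ⟨comp_mem_EL hη hμ, ?_⟩
      classical
      -- The map induced by `η` on the range of `r ∘ μ`, well defined by `EL_compat`; its values
      -- elsewhere play no role.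
      let s : Y → Y := fun y => if h : ∃ p, r (μ p) = y then r (η (μ h.choose)) else y
      refine (hf.image s).subset ?_
      rintro _ ⟨p, rfl⟩
      refine ⟨r (μ p), ⟨p, rfl⟩, ?_⟩
      have h : ∃ q, r (μ q) = r (μ p) := ⟨p, rfl⟩
      simp only [s, dif_pos h]
      exact EL_compat hr hG hη h.choose_spec
    · rintro η hη μ ⟨hμ, hf⟩
      exact ⟨comp_mem_EL hμ hη, hf.subset (Set.range_comp_subset_range η (r ∘ μ))⟩
  have hu : (Set.range (r ∘ u.1)).Finite := (hM u.2.1).2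
  have := hu.to_subtype
  choose q hq using fun y : Set.range (r ∘ u.1) => y.2
  let ev : EllisGroup M u → Set.range (r ∘ u.1) → Set.range (r ∘ u.1) := fun η y =>
    ⟨r (η.1 (q y)), η.1 (q y), congrArg r (congrFun η.idempotent_comp_val (q y))⟩
  have key : ∀ η θ, ev η = ev θ → factorCon M u hr hG η θ := by
    intro η θ h
    have key1 : ∀ (η : EllisGroup M u) p, r (η.1 p) = (ev η ⟨r (u.1 p), p, rfl⟩).1 := by
      intro η p
      have e := EL_compat hr hG η.val_mem_EL (hq ⟨r (u.1 p), p, rfl⟩)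
      have e1 := congrFun η.val_comp_idempotent
      simp only [Function.comp_apply] at e1 e
      rw [e1] at e
      rw [← e1 p]
      exact e.symm
    funext p
    exact (key1 η p).trans ((congrArg Subtype.val (congrFun h _)).trans (key1 θ p).symm)
  refine Finite.of_injective (fun c : (factorCon M u hr hG).Quotient => ev (Quotient.out c)) ?_
  intro c d h
  have := key _ _ h
  rw [← Quotient.out_eq c, ← Quotient.out_eq d]
  exact Quotient.sound this

/-- If the points of `X` are separated by factors on each of which some element of the Ellis
semigroup has finite range, then the Ellis group is profinite. -/
theorem isProfinite_ellisGroup [CompactSpace X] [T2Space X] [ContinuousConstSMul G X] {ι : Type*} {Y : ι → Type*} [∀ i, TopologicalSpace (Y i)]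
    [∀ i, T2Space (Y i)] {r : ∀ i, X → Y i} (hr : ∀ i, Continuous (r i))
    (hG : ∀ i (g : G) p p', r i p = r i p' → r i (g • p) = r i (g • p'))
    (hsep : ∀ p p', (∀ i, r i p = r i p') → p = p')
    (hfin : ∀ i, ∃ η ∈ EL G X, (Set.range (r i ∘ η)).Finite) :
    IsProfinite (EllisGroup M u) := by
  let Q : ι → Type _ := fun i => (factorCon M u (hr i) (hG i)).Quotient
  let _ : ∀ i, TopologicalSpace (Q i) := fun i => ⊥
  have : ∀ i, DiscreteTopology (Q i) := fun i => ⟨rfl⟩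
  let _ : ∀ i, Group (Q i) := fun i => inferInstanceAs (Group (Con.Quotient _))
  have : ∀ i, Finite (Q i) := fun i => finite_factorCon_quotient (hr i) (hG i) (hfin i)
  let j : EllisGroup M u →* ∀ i, Q i := MonoidHom.pi fun i => (factorCon M u (hr i) (hG i)).mk'
  have hcont : Continuous j := by
    refine continuous_pi fun i => continuous_iff_isClosed.2 fun s _ => ?_
    have : (fun η => j η i) ⁻¹' s = ⋃ c ∈ s, (fun η => j η i) ⁻¹' {c} := by ext; simp
    rw [this]
    refine s.toFinite.isClosed_biUnion fun c _ => ?_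
    obtain ⟨θ, rfl⟩ := Quotient.exists_rep c
    have h := isClosed_factorCon_class (hr i) (hG i) θ
    convert h using 1
    ext η
    exact Con.eq _
  have hinj : Function.Injective j := by
    intro η θ h
    refine EllisGroup.ext (funext fun p => hsep _ _ fun i => ?_)
    exact congrFun ((Con.eq (factorCon M u (hr i) (hG i))).1 (congrFun h i)) p
  -- The source is compact and the target Hausdorff. Continuity of the group operations and
  -- separation in uM are then inherited from the product.
  have hemb := hcont.isClosedEmbedding hinj
  have : IsTopologicalGroup (EllisGroup M u) := hemb.isInducing.topologicalGroup j
  have : T2Space (EllisGroup M u) := hemb.isEmbedding.t2Space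
  have : TotallyDisconnectedSpace (EllisGroup M u) :=
    ⟨hemb.isEmbedding.isTotallyDisconnected (isTotallyDisconnected_of_totallyDisconnectedSpace _)⟩
  exact ⟨ProfiniteGrp.of (EllisGroup M u), ⟨ContinuousMulEquiv.refl _⟩⟩

end Profinite

end EllisDynamics

namespace MonsterModel

/-! ### Global types, their realizations in elementary extensions, and their topology. -/

section Realization

variable {L : FirstOrder.Language.{u, v}} {C : Type w} {β : Type w'}

/-- The sentence with constants for the parameters and the variables that corresponds to a
formula with parameters. -/
def instanceSentence (θ : L.Formula (C ⊕ β)) : L[[C]][[β]].Sentence :=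
  Formula.equivSentence (L := L[[C]]) (BoundedFormula.constantsVarsEquiv.symm θ)

theorem exists_eq_instanceSentence (ψ : L[[C]][[β]].Sentence) :
    ∃ θ : L.Formula (C ⊕ β), ψ = instanceSentence θ :=
  ⟨BoundedFormula.constantsVarsEquiv (Formula.equivSentence.symm ψ), by simp [instanceSentence]⟩

section

variable (L C β) (K : Type*) [S : L[[C]][[β]].Structure K]

/-- The reduct to `L` of a structure with constants for the parameters and the variables. -/
abbrev baseReduct : L.Structure K :=
  letI : L[[C]].Structure K := (L[[C]].lhomWithConstants β).reduct K
  (L.lhomWithConstants C).reduct K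

/-- The interpretation of the constants for the parameters. -/
def paramValue (c : C) : K :=
  ((L[[C]].lhomWithConstants β).onFunction (L.con c) : L[[C]][[β]].Constants)

/-- The interpretation of the constants for the variables. -/
def varValue (b : β) : K := (L[[C]].con b : L[[C]][[β]].Constants)

end

theorem realize_instanceSentence (K : Type*) [S : L[[C]][[β]].Structure K]
    (θ : L.Formula (C ⊕ β)) : K ⊨ instanceSentence θ ↔
      letI := baseReduct L C β K
      θ.Realize (Sum.elim (paramValue L C β K) (varValue L C β K)) := by
  let S1 : L[[C]].Structure K := (L[[C]].lhomWithConstants β).reduct K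
  let S0 : L.Structure K := (L.lhomWithConstants C).reduct K
  refine (Formula.realize_equivSentence K _).trans ?_
  rw [Formula.Realize, ← BoundedFormula.realize_constantsVarsEquiv, Equiv.apply_symm_apply]
  rfl

theorem realize_rename_instanceSentence [L.Structure C] (K : Type*)
    [S : L[[C]][[β]].Structure K] (τ : C ≃[L] C) (θ : L.Formula (C ⊕ β)) :
    K ⊨ (renameParams τ β).onSentence (instanceSentence θ) ↔
      letI := baseReduct L C β K
      θ.Realize (Sum.elim (paramValue L C β K ∘ τ) (varValue L C β K)) := by
  let S' : L[[C]][[β]].Structure K := (renameParams τ β).reduct K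
  refine (@LHom.realize_onSentence _ _ K S' S (renameParams τ β)
    (@LHom.isExpansionOn_reduct _ _ (renameParams τ β) K S) _).trans ?_
  exact @realize_instanceSentence _ _ _ K S' θ

theorem realize_onSentence_addConstants (K : Type*) [S : L[[C]][[β]].Structure K]
    (θ : L.Formula β) :
    K ⊨ (LHom.addConstants β (L.lhomWithConstants C)).onSentence (Formula.equivSentence θ) ↔
      letI := baseReduct L C β K
      θ.Realize (varValue L C β K) := by
  let S' : L[[β]].Structure K := (LHom.addConstants β (L.lhomWithConstants C)).reduct K
  let S1 : L[[C]].Structure K := (L[[C]].lhomWithConstants β).reduct K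
  let S0 : L.Structure K := (L.lhomWithConstants C).reduct K
  refine (@LHom.realize_onSentence _ _ K S' S (LHom.addConstants β (L.lhomWithConstants C))
    (@LHom.isExpansionOn_reduct _ _ (LHom.addConstants β (L.lhomWithConstants C)) K S) _).trans ?_
  have : (L.lhomWithConstants β).IsExpansionOn K :=
    ⟨fun _ _ => rfl, fun _ _ => rfl⟩
  exact Formula.realize_equivSentence K θ

theorem realize_onSentence_lhomWithConstants (K : Type*) [S : L[[C]][[β]].Structure K]
    (θ : L.Formula C) :
    K ⊨ (L[[C]].lhomWithConstants β).onSentence (Formula.equivSentence θ) ↔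
      letI := baseReduct L C β K
      θ.Realize (paramValue L C β K) := by
  let S1 : L[[C]].Structure K := (L[[C]].lhomWithConstants β).reduct K
  let S0 : L.Structure K := (L.lhomWithConstants C).reduct K
  exact (LHom.realize_onSentence K (L[[C]].lhomWithConstants β) _).trans
    (Formula.realize_equivSentence K θ)

namespace GlobalType

variable [L.Structure C]

theorem exists_model (p : GlobalType L C β) : ∃ (K : Type (max u v w w')) (_ : L[[C]][[β]].Structure K),
    Nonempty K ∧ ∀ ψ, ψ ∈ p ↔ K ⊨ ψ := by
  obtain ⟨K⟩ := p.isMaximal.1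
  exact ⟨K, inferInstance, inferInstance, fun ψ =>
    (p.isMaximal.mem_iff_models ψ).trans (p.isMaximal.isComplete.realize_sentence_iff ψ K).symm⟩

/-- Every global type is realized in an elementary extension. -/
theorem exists_realization (p : GlobalType L C β) : ∃ (K : Type (max u v w w')) (_ : L.Structure K)
    (f : C → K) (d : β → K), Nonempty K ∧
      (∀ θ : L.Formula C, θ.Realize (id : C → C) ↔ θ.Realize f) ∧
      (∀ θ : L.Formula (C ⊕ β), instanceSentence θ ∈ p ↔ θ.Realize (Sum.elim f d)) ∧
      (∀ θ : L.Formula β, (LHom.addConstants β (L.lhomWithConstants C)).onSentence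
        (Formula.equivSentence θ) ∈ p ↔ θ.Realize d) := by
  obtain ⟨K, S, hK, h⟩ := p.exists_model
  have key : ∀ θ : L.Formula C, θ.Realize (id : C → C) →
      letI := baseReduct L C β K
      θ.Realize (paramValue L C β K) := by
    intro θ hθ
    refine (realize_onSentence_lhomWithConstants K θ).1 ((h _).1 (p.subset ⟨_, ?_, rfl⟩))
    exact mem_completeTheory.2 ((Formula.realize_equivSentence C θ).2 hθ)
  refine ⟨K, baseReduct L C β K, paramValue L C β K, varValue L C β K, hK,
    fun θ => ⟨key θ, fun hθ => ?_⟩,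
    fun θ => (h _).trans (realize_instanceSentence K θ),
    fun θ => (h _).trans (realize_onSentence_addConstants K θ)⟩
  by_contra hcon
  let _ := baseReduct L C β K
  exact (Formula.realize_not).1 (key θ.not (Formula.realize_not.2 hcon)) hθ

theorem instanceSentence_mem_congr (p : GlobalType L C β) {θ θ' : L.Formula (C ⊕ β)}
    (h : ∀ (K : Type (max u v w w')) [L.Structure K] (x : C ⊕ β → K), θ.Realize x ↔ θ'.Realize x) :
    instanceSentence θ ∈ p ↔ instanceSentence θ' ∈ p := by
  obtain ⟨K, _, f, d, -, -, hp, -⟩ := p.exists_realization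
  rw [hp, hp]
  exact h K _

/-- Translates the action, defined by renaming constants, into relabelling of free variables, so
that it can be computed in a realization. -/
theorem instanceSentence_mem_smul (σ : C ≃[L] C) (p : GlobalType L C β)
    (θ : L.Formula (C ⊕ β)) :
    instanceSentence θ ∈ σ • p ↔
      instanceSentence (θ.relabel (Sum.map (σ⁻¹ : C ≃[L] C) id)) ∈ p := by
  obtain ⟨K, S, -, h⟩ := p.exists_model
  change (renameParams σ⁻¹ β).onSentence (instanceSentence θ) ∈ p ↔ _
  let _ := baseReduct L C β K
  rw [h, h, realize_rename_instanceSentence, realize_instanceSentence]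
  refine Iff.trans (iff_of_eq (congrArg θ.Realize ?_)) Formula.realize_relabel.symm
  ext (_ | _) <;> rfl

theorem contains_smul (σ : C ≃[L] C) (p : GlobalType L C β) {ι : Type*}
    (φ : L.Formula (ι ⊕ β)) (a : ι → C) :
    (σ • p).Contains φ a ↔ p.Contains φ ((σ⁻¹ : C ≃[L] C) ∘ a) := by
  refine (instanceSentence_mem_smul σ p _).trans (p.instanceSentence_mem_congr fun K _ x => ?_)
  simp only [Formula.realize_relabel, Function.comp_assoc, Sum.map_comp_map]
  rfl

theorem ext_instanceSentence {p q : GlobalType L C β}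
    (h : ∀ θ : L.Formula (C ⊕ β), instanceSentence θ ∈ p ↔ instanceSentence θ ∈ q) : p = q :=
  SetLike.ext fun ψ => by
    obtain ⟨θ, rfl⟩ := exists_eq_instanceSentence ψ
    exact h θ

/-- Every instance of a formula uses only finitely many parameters. -/
theorem exists_contains_iff (θ : L.Formula (C ⊕ β)) :
    ∃ (k : ℕ) (φ : L.Formula (Fin k ⊕ β)) (a : Fin k → C),
      ∀ p : GlobalType L C β, instanceSentence θ ∈ p ↔ p.Contains φ a := by
  classical
  let s : Finset C := θ.freeVarFinset.toLeft
  let e := s.equivFin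
  let g : θ.freeVarFinset → Fin s.card ⊕ β := fun x =>
    match h : x.1 with
    | Sum.inl c => Sum.inl (e ⟨c, Finset.mem_toLeft.2 (h ▸ x.2)⟩)
    | Sum.inr b => Sum.inr b
  refine ⟨s.card, θ.restrictFreeVar g, fun i => (e.symm i).1, fun p => ?_⟩
  refine p.instanceSentence_mem_congr fun K _ x => ?_
  rw [Formula.realize_relabel]
  refine (BoundedFormula.realize_restrictFreeVar (v := x ∘ Sum.map (fun i => (e.symm i).1) id) x ?_).symm
  rintro ⟨c | b, hx⟩ <;> simp [g]

theorem ext {p q : GlobalType L C β}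
    (h : ∀ (k : ℕ) (φ : L.Formula (Fin k ⊕ β)) (a : Fin k → C),
      p.Contains φ a ↔ q.Contains φ a) : p = q := by
  refine ext_instanceSentence fun θ => ?_
  obtain ⟨k, φ, a, hφ⟩ := exists_contains_iff (β := β) θ
  rw [hφ, hφ, h]

theorem isClopen_contains {ι : Type*} (φ : L.Formula (ι ⊕ β)) (a : ι → C) :
    IsClopen {p : GlobalType L C β | p.Contains φ a} :=
  CompleteType.isClopen_typesWith _

instance : ContinuousConstSMul (C ≃[L] C) (GlobalType L C β) where
  continuous_const_smul σ := continuous_generateFrom_iff.2 <| by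
    rintro _ ⟨ψ, rfl⟩
    exact CompleteType.isOpen_typesWith ((renameParams σ⁻¹ β).onSentence ψ)

end GlobalType

variable [L.Structure C]

theorem isClosed_typesExtending {T : L.Theory} (q : T.CompleteType β) :
    IsClosed (typesExtending C q : Set (GlobalType L C β)) := by
  have : (typesExtending C q : Set (GlobalType L C β)) = ⋂ ψ ∈ q,
      {p | (LHom.addConstants β (L.lhomWithConstants C)).onSentence ψ ∈ p} := by
    ext p
    simp only [Set.mem_iInter]
    rfl
  rw [this]
  exact isClosed_biInter fun ψ _ => CompleteType.isClosed_typesWith _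

instance {T : L.Theory} (q : T.CompleteType β) : CompactSpace (typesExtending C q) :=
  isCompact_iff_compactSpace.1 (isClosed_typesExtending q).isCompact

instance {T : L.Theory} (q : T.CompleteType β) :
    ContinuousConstSMul (C ≃[L] C) (typesExtending C q) where
  continuous_const_smul σ :=
    (continuous_subtype_val.const_smul σ).subtype_mk _

end Realization

/-! ### The flow of types extending the type of the enumeration. -/

section EnumTypes

variable {L : FirstOrder.Language.{u, v}} (T : L.Theory) (C : Type w) [L.Structure C] [Nonempty C]
  [C ⊨ T]

instance : CompactSpace (enumTypes T C) := inferInstanceAs (CompactSpace (typesExtending C _))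

instance : ContinuousConstSMul (C ≃[L] C) (enumTypes T C) :=
  inferInstanceAs (ContinuousConstSMul (C ≃[L] C) (typesExtending C _))

theorem isClopen_enumTypes_contains {ι : Type*} (φ : L.Formula (ι ⊕ C)) (a : ι → C) :
    IsClopen {p : enumTypes T C | p.1.Contains φ a} :=
  (GlobalType.isClopen_contains φ a).preimage continuous_subtype_val

theorem nonempty_enumTypes : Nonempty (enumTypes T C) := by
  refine ⟨⟨(L.elementaryDiagram C).typeOf (id : C → C), fun ψ hψ => ?_⟩⟩
  obtain ⟨θ, rfl⟩ := Formula.equivSentence.surjective ψ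
  have hθ : θ.Realize (id : C → C) :=
    (Theory.CompleteType.formula_mem_typeOf (T := T)).1 hψ
  exact mem_completeTheory.2 ((realize_onSentence_addConstants C θ).2 hθ)

end EnumTypes

/-! ### Equality of types across structures, saturation and homogeneity. -/

section SameTypeIn

variable (L : FirstOrder.Language.{u, v}) {C : Type*} {K : Type*} [L.Structure C] [L.Structure K]

/-- Two tuples in two structures have the same type over the empty set. -/
def SameTypeIn {ι : Type*} (a : ι → C) (b : ι → K) : Prop :=
  ∀ φ : L.Formula ι, φ.Realize a ↔ φ.Realize b

variable {L}

theorem SameTypeIn.symm {ι : Type*} {a : ι → C} {b : ι → K} (h : SameTypeIn L a b) :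
    SameTypeIn L b a := fun φ => (h φ).symm

theorem SameTypeIn.trans {N : Type*} [L.Structure N] {ι : Type*} {a : ι → C} {b : ι → K}
    {d : ι → N} (h : SameTypeIn L a b) (h' : SameTypeIn L b d) : SameTypeIn L a d :=
  fun φ => (h φ).trans (h' φ)

theorem SameTypeIn.comp {ι ι' : Type*} {a : ι → C} {b : ι → K} (h : SameTypeIn L a b)
    (g : ι' → ι) : SameTypeIn L (a ∘ g) (b ∘ g) := fun φ => by
  have := h (φ.relabel g)
  rwa [Formula.realize_relabel, Formula.realize_relabel] at this

theorem sameTypeIn_comp_equiv {ι : Type*} (σ : C ≃[L] C) (a : ι → C) :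
    SameTypeIn L (σ ∘ a) a := fun φ => StrongHomClass.realize_formula σ φ

theorem sameTypeIn_of_finset {γ : Type*} {a : γ → C} {b : γ → K}
    (h : ∀ s : Finset γ, SameTypeIn L (fun x : s => a x) (fun x : s => b x)) :
    SameTypeIn L a b := by
  classical
  intro φ
  have := h φ.freeVarFinset (BoundedFormula.restrictFreeVar φ id)
  exact (BoundedFormula.realize_restrictFreeVar (f := id)
    (v := fun x : φ.freeVarFinset => a x) a fun _ => rfl).symm.trans
    (this.trans (BoundedFormula.realize_restrictFreeVar (f := id)
      (v := fun x : φ.freeVarFinset => b x) b fun _ => rfl))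

theorem SameTypeIn.eq_iff {ι : Type*} {a : ι → C} {b : ι → K} (h : SameTypeIn L a b) (i j : ι) :
    a i = a j ↔ b i = b j := by
  have := h (Term.equal (Term.var i) (Term.var j))
  simpa only [Formula.realize_equal, Term.realize_var] using this

end SameTypeIn

section Saturation

variable {L : FirstOrder.Language.{u, v}} {κ : Cardinal.{w}} {C : Type w} [L.Structure C]
  [Nonempty C] {K : Type w'} [L.Structure K] [Nonempty K]

/-- Interpreting the constants for the range of `a` by the entries of `b` makes K a model of the
theory of C with these constants. Saturation realizes the type of `n` in C. -/
theorem IsMonster.exists_extend_one (hC : IsMonster L κ C) {ι : Type w} (hι : #ι < κ)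
    {a : ι → C} {b : ι → K} (h : SameTypeIn L a b) (n : K) :
    ∃ c : C, SameTypeIn L (Sum.elim a fun _ : Fin 1 => c) (Sum.elim b fun _ : Fin 1 => n) := by
  let A : Set C := Set.range a
  -- Repetitions in `a` make the choice of index harmless, since `a i = a j` iff `b i = b j`.
  let pre : A → ι := fun x => x.2.choose
  have hpre : ∀ x, a (pre x) = x := fun x => x.2.choose_spec
  let f : A → K := b ∘ pre
  have hf : ∀ i, f ⟨a i, i, rfl⟩ = b i := fun i => (h.eq_iff _ _).1 (hpre ⟨a i, i, rfl⟩)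
  let _ : (constantsOn A).Structure K := constantsOn.structure f
  have hK : K ⊨ L[[A]].completeTheory C := by
    rw [Theory.model_iff]
    intro ψ hψ
    obtain ⟨θ, rfl⟩ := Formula.equivSentence.surjective ψ
    rw [mem_completeTheory] at hψ
    have h1 := (Formula.realize_equivSentence C θ).1 hψ
    refine (Formula.realize_equivSentence K θ).2 ((h.comp pre θ).1 ?_)
    convert h1 using 1
    exact funext hpre
  obtain ⟨c, hc⟩ := hC.saturated A (mk_range_le.trans_lt hι)
    ((L[[A]].completeTheory C).typeOf fun _ : Fin 1 => n)
  refine ⟨c 0, fun φ => ?_⟩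
  let θ : L[[A]].Formula (Fin 1) := BoundedFormula.constantsVarsEquiv.symm
    (φ.relabel (Sum.map (fun i => (⟨a i, i, rfl⟩ : A)) id))
  have key : Formula.equivSentence θ ∈ (L[[A]].completeTheory C).typeOf c ↔
      Formula.equivSentence θ ∈ (L[[A]].completeTheory C).typeOf fun _ : Fin 1 => n := by
    rw [hc]
  rw [Theory.CompleteType.formula_mem_typeOf, Theory.CompleteType.formula_mem_typeOf] at key
  simp only [Formula.Realize] at key
  rw [← BoundedFormula.realize_constantsVarsEquiv, ← BoundedFormula.realize_constantsVarsEquiv,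
    Equiv.apply_symm_apply] at key
  have e1 := (Formula.realize_relabel (φ := φ) (g := Sum.map (fun i => (⟨a i, i, rfl⟩ : A)) id)
    (v := Sum.elim (fun x : A => ((L.con x : L[[A]].Constants) : C)) c))
  have e2 := (Formula.realize_relabel (φ := φ) (g := Sum.map (fun i => (⟨a i, i, rfl⟩ : A)) id)
    (v := Sum.elim (fun x : A => ((L.con x : L[[A]].Constants) : K)) fun _ => n))
  have key' := e1.symm.trans (key.trans e2)
  have e3 : Sum.elim a (fun _ : Fin 1 => c 0) =
      Sum.elim (fun x : A => ((L.con x : L[[A]].Constants) : C)) c ∘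
        Sum.map (fun i => (⟨a i, i, rfl⟩ : A)) id := by
    ext (i | i)
    · exact (coe_con L A (a := (⟨a i, i, rfl⟩ : A))).symm
    · exact congrArg c (Subsingleton.elim 0 i)
  have e4 : Sum.elim b (fun _ : Fin 1 => n) =
      Sum.elim (fun x : A => ((L.con x : L[[A]].Constants) : K)) (fun _ => n) ∘
        Sum.map (fun i => (⟨a i, i, rfl⟩ : A)) id := by
    ext (i | i)
    · exact (hf i).symm
    · rfl
  rw [e3, e4]
  exact key'

/-- Transfinite recursion adds one element at a time. Limits need no separate case: equality of
types is finitary and a nonempty finite set of indices has a largest element, while `h0` covers the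
empty set. -/
theorem IsMonster.exists_sameTypeIn (hC : IsMonster L κ C) {γ : Type w} (hγ : #γ < κ)
    (h0 : ∀ ψ : L.Formula PEmpty.{1}, ψ.Realize (PEmpty.elim : _ → C) ↔
      ψ.Realize (PEmpty.elim : _ → K)) (b : γ → K) : ∃ a : γ → C, SameTypeIn L a b := by
  classical
  obtain ⟨_, _⟩ := exists_wellFoundedLT γ
  let P : ∀ x : γ, ({y // y < x} → C) → C → Prop := fun x r c =>
    SameTypeIn L (Sum.elim r fun _ : Fin 1 => c) (Sum.elim (fun y => b y) fun _ : Fin 1 => b x)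
  -- The default value is never taken, as the induction in `main` shows.
  let a : γ → C := (wellFounded_lt (α := γ)).fix fun x r =>
    if h : ∃ c, P x (fun y => r y y.2) c then h.choose else Classical.arbitrary C
  have ha : ∀ x, (∃ c, P x (fun y => a y) c) → P x (fun y => a y) (a x) := by
    intro x h
    have : a x = if h : ∃ c, P x (fun y => a y) c then h.choose else Classical.arbitrary C :=
      (wellFounded_lt (α := γ)).fix_eq _ x
    rw [this, dif_pos h]
    exact h.choose_spec
  have hfin : ∀ {D : Type w} (g : D → γ),
      (∀ x : D, SameTypeIn L (fun y : {y // y ≤ g x} => a y) (fun y : {y // y ≤ g x} => b y)) →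
      SameTypeIn L (a ∘ g) (b ∘ g) := by
    intro D g h
    refine sameTypeIn_of_finset fun s => ?_
    rcases s.eq_empty_or_nonempty with rfl | hs
    · intro φ
      have := h0 (φ.relabel fun x => absurd x.2 (Finset.notMem_empty _))
      rw [Formula.realize_relabel, Formula.realize_relabel] at this
      convert this using 2 <;> exact Subsingleton.elim _ _
    · obtain ⟨m, -, hm⟩ := s.exists_max_image g hs
      exact (h m).comp fun x : s => ⟨g x, hm x x.2⟩
  have main : ∀ x : γ, SameTypeIn L (fun y : {y // y ≤ x} => a y) (fun y => b y) := by
    intro x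
    induction x using (wellFounded_lt (α := γ)).induction with
    | _ x ih =>
      have h1 := hfin (fun y : {y // y < x} => y.1) fun y => ih y y.2
      have h2 := ha x (hC.exists_extend_one ((mk_subtype_le _).trans_lt hγ) h1 (b x))
      let g : {y // y ≤ x} → {y // y < x} ⊕ Fin 1 := fun y =>
        if h : y.1 < x then Sum.inl ⟨y, h⟩ else Sum.inr 0
      convert h2.comp g using 1 <;>
      · funext y
        by_cases h : y.1 < x
        · simp [g, h]
        · have := y.2.eq_of_not_lt h
          simp [g, this]
  exact ⟨a, hfin id main⟩

theorem IsMonster.exists_equiv (hC : IsMonster L κ C) {ι : Type w} (hι : #ι < κ) {a b : ι → C}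
    (h : SameTypeIn L a b) : ∃ σ : C ≃[L] C, σ ∘ a = b := by
  obtain ⟨σ, hσ⟩ := hC.homogeneous ι hι a b h
  exact ⟨σ, funext hσ⟩

theorem IsMonster.exists_equiv_fin (hC : IsMonster L κ C) {k : ℕ} {a b : Fin k → C}
    (h : SameType L a b) : ∃ σ : C ≃[L] C, σ ∘ a = b := by
  obtain ⟨σ, hσ⟩ := hC.exists_equiv (ι := ULift (Fin k)) ((lt_aleph0_of_finite _).trans hC.aleph0_lt)
    (SameTypeIn.comp (a := a) (b := b) h ULift.down)
  exact ⟨σ, funext fun i => congrFun hσ ⟨i⟩⟩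

/-- A small tuple in an elementary extension has a copy in the monster model over a small tuple
of parameters. -/
theorem IsMonster.exists_copy (hC : IsMonster L κ C) {f : C → K}
    (hf : SameTypeIn L (id : C → C) f) {ι α : Type w} (hι : #ι < κ) (hα : #α < κ)
    (a : ι → C) (e : α → K) :
    ∃ e' : α → C, SameTypeIn L (Sum.elim a e') (Sum.elim (f ∘ a) e) := by
  have hγ : #(ι ⊕ α) < κ := by
    rw [mk_sum, lift_id, lift_id]
    exact add_lt_of_lt hC.aleph0_lt.le hι hα
  obtain ⟨x, hx⟩ := hC.exists_sameTypeIn hγ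
    (fun ψ => by
      have := hf.comp PEmpty.elim ψ
      convert this using 2 <;> exact Subsingleton.elim _ _)
    (Sum.elim (f ∘ a) e)
  -- The first half of `x` only has the type of `a`; homogeneity moves it onto `a`.
  obtain ⟨σ, hσ⟩ := hC.exists_equiv hι ((hx.comp Sum.inl).trans (hf.comp a).symm)
  refine ⟨σ ∘ x ∘ Sum.inr, SameTypeIn.trans ?_ hx⟩
  convert sameTypeIn_comp_equiv σ x using 1
  ext (i | i)
  · exact (congrFun hσ i).symm
  · rfl

end Saturation

/-! ### Ramsey properties restated with automorphisms. -/

section Colorings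

variable {L : FirstOrder.Language.{u, v}} {κ : Cardinal.{w}} {C : Type w} [L.Structure C]

/-- The externally definable coloring given by formulas and global types. -/
noncomputable def externalColoring {k : ℕ} (a : Fin k → C) {n : ℕ}
    (φ : Fin n → L.Formula (Fin k ⊕ C)) (p : Fin n → GlobalType L C C) : Coloring L a n :=
  fun a' i => @decide ((p i).Contains (φ i) a'.1) (Classical.propDecidable _)

theorem externalColoring_isGivenBy {k : ℕ} (a : Fin k → C) {n : ℕ}
    (φ : Fin n → L.Formula (Fin k ⊕ C)) (p : Fin n → GlobalType L C C) :
    (externalColoring a φ p).IsGivenBy φ p := fun _ _ => @decide_eq_true_iff _ (Classical.propDecidable _)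

theorem sameType_comp_equiv (σ : C ≃[L] C) {k : ℕ} {a' a : Fin k → C} (h : SameType L a' a) :
    SameType L (σ ∘ a') a :=
  SameTypeIn.trans (sameTypeIn_comp_equiv σ a') h

theorem comp_mem_copies (σ : C ≃[L] C) {k : ℕ} {a a' : Fin k → C} {m : ℕ}
    {b : Fin m → C} (h : a' ∈ copies L (Set.range b) a) :
    σ ∘ a' ∈ copies L (Set.range (σ ∘ b)) a :=
  ⟨fun i => let ⟨j, hj⟩ := h.1 i; ⟨j, congrArg σ hj⟩, sameType_comp_equiv σ h.2⟩

variable [Nonempty C]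

theorem HasEDEERP.exists_equiv (hC : IsMonster L κ C) (h : HasEDEERP L C) {k : ℕ}
    (a : Fin k → C) {S : Set C} (hS : S.Finite) (haS : Set.range a ⊆ S) {n : ℕ}
    (φ : Fin n → L.Formula (Fin k ⊕ C)) (p : Fin n → GlobalType L C C) :
    ∃ σ : C ≃[L] C, ∀ a' ∈ copies L S a, ∀ i,
      (p i).Contains (φ i) (σ ∘ a') ↔ (p i).Contains (φ i) (σ ∘ a) := by
  obtain ⟨m, b, rfl⟩ := hS.fin_embedding
  obtain ⟨b', hb', ε, hε⟩ := h k m a b haS n (externalColoring a φ p)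
    ⟨C, φ, p, externalColoring_isGivenBy a φ p⟩
  obtain ⟨σ, rfl⟩ := hC.exists_equiv_fin (a := b) fun θ => (hb'.2 θ).symm
  have key : ∀ a' ∈ copies L (Set.range b) a, ∀ i,
      (p i).Contains (φ i) (σ ∘ a') ↔ ε i = true := by
    intro a' ha' i
    have h1 := comp_mem_copies σ ha'
    have h2 : externalColoring a φ p ⟨σ ∘ a', fun _ => trivial, h1.2⟩ ∈
        (externalColoring a φ p).colorsIn (σ ∘ b) := ⟨_, h1, rfl⟩
    rw [hε] at h2
    have h3 := externalColoring_isGivenBy a φ p ⟨σ ∘ a', fun _ => trivial, h1.2⟩ i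
    rw [Set.mem_singleton_iff.1 h2] at h3
    exact h3.symm
  refine ⟨σ, fun a' ha' i => (key a' ha' i).trans (key a ⟨?_, fun _ => Iff.rfl⟩ i).symm⟩
  exact fun i => haS ⟨i, rfl⟩

/-- The bound depends on `a` and `φ` alone, not on `S` or on the number of types; the later
compactness argument rests on this uniformity. -/
theorem HasSepFinEDEERdeg.exists_equiv (hC : IsMonster L κ C) {T : L.Theory} [C ⊨ T]
    (h : HasSepFinEDEERdeg C T) {k : ℕ} (a : Fin k → C) (φ : L.Formula (Fin k ⊕ C)) :
    ∃ l : ℕ, ∀ S : Set C, S.Finite → Set.range a ⊆ S → ∀ (n : ℕ) (p : Fin n → enumTypes T C),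
      ∃ σ : C ≃[L] C,
        ((fun a' i => (p i).1.Contains φ (σ ∘ a')) '' copies L S a).encard ≤ l := by
  classical
  obtain ⟨l, hl⟩ := h k a C {φ} (Set.finite_singleton φ) (T.typeOf (id : C → C))
  refine ⟨l, fun S hS haS n p => ?_⟩
  obtain ⟨m, b, rfl⟩ := hS.fin_embedding
  let c := externalColoring a (fun _ => φ) fun i => (p i).1
  obtain ⟨b', hb', hcard⟩ := hl m b haS n c
    ⟨fun _ => φ, fun i => (p i).1, fun _ => rfl, fun i => (p i).2,
      externalColoring_isGivenBy a _ _⟩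
  obtain ⟨σ, rfl⟩ := hC.exists_equiv_fin (a := b) fun θ => (hb'.2 θ).symm
  refine ⟨σ, le_trans ?_ hcard⟩
  refine le_trans (Set.encard_le_encard ?_)
    (Set.encard_image_le (fun (e : Fin n → Bool) i => e i = true) _)
  rintro _ ⟨a', ha', rfl⟩
  have h1 := comp_mem_copies σ ha'
  refine ⟨c ⟨σ ∘ a', fun _ => trivial, h1.2⟩, ⟨_, h1, rfl⟩, funext fun i => propext ?_⟩
  exact externalColoring_isGivenBy a _ _ _ i

end Colorings

/-! ### EDEERP: invariant types and singleton minimal left ideals. -/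

section Ramsey

open EllisDynamics

variable {L : FirstOrder.Language.{u, v}} {κ : Cardinal.{w}} {T : L.Theory} {C : Type w}
  [L.Structure C] [Nonempty C] [C ⊨ T]

theorem contains_smul_inv (σ : C ≃[L] C) (p : enumTypes T C) {ι : Type*}
    (φ : L.Formula (ι ⊕ C)) (a : ι → C) :
    (σ⁻¹ • p).1.Contains φ a ↔ p.1.Contains φ (σ ∘ a) := by
  have := GlobalType.contains_smul σ⁻¹ p.1 φ a
  rwa [inv_inv] at this

theorem isClosed_contains_iff {ι : Type*} (φ : L.Formula (ι ⊕ C)) (a b : ι → C) :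
    IsClosed {p : enumTypes T C | p.1.Contains φ a ↔ p.1.Contains φ b} := by
  have ha := isClopen_enumTypes_contains T C φ a
  have hb := isClopen_enumTypes_contains T C φ b
  have : {p : enumTypes T C | p.1.Contains φ a ↔ p.1.Contains φ b} =
      ({p | p.1.Contains φ a}ᶜ ∪ {p | p.1.Contains φ b}) ∩
        ({p | p.1.Contains φ b}ᶜ ∪ {p | p.1.Contains φ a}) := by
    ext p
    simp only [Set.mem_ofPred_eq, Set.mem_inter_iff, Set.mem_union, Set.mem_compl_iff]
    tauto
  rw [this]
  exact ((ha.compl.union hb).inter (hb.compl.union ha)).1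

/-- The types that treat all realizations of `tp(a)` in the same way. -/
def homogeneousTypes (T : L.Theory) [C ⊨ T] {k : ℕ} (a : Fin k → C) : Set (enumTypes T C) :=
  {p | ∀ (φ : L.Formula (Fin k ⊕ C)) (a' : Fin k → C), SameType L a' a →
    (p.1.Contains φ a' ↔ p.1.Contains φ a)}

theorem isClosed_homogeneousTypes {k : ℕ} (a : Fin k → C) :
    IsClosed (homogeneousTypes T a) := by
  simp only [homogeneousTypes, Set.ofPred_forall]
  exact isClosed_iInter fun φ => isClosed_iInter fun a' => isClosed_iInter fun _ =>
    isClosed_contains_iff φ a' a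

theorem smul_mem_homogeneousTypes {k : ℕ} {a : Fin k → C} {p : enumTypes T C}
    (hp : p ∈ homogeneousTypes T a) (σ : C ≃[L] C) : σ • p ∈ homogeneousTypes T a := by
  intro φ a' ha'
  have h := fun x => GlobalType.contains_smul σ p.1 φ x
  refine (h a').trans (Iff.trans ?_ (h a).symm)
  refine (hp φ _ (sameType_comp_equiv σ⁻¹ ha')).trans (hp φ _ ?_).symm
  exact sameType_comp_equiv σ⁻¹ fun _ => Iff.rfl

/-- Each condition is closed and concerns one value of `η`. Finitely many conditions form a single
coloring, one bit per condition, on a finite set S. An automorphism `σ` making it constant yields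
the solution `σ⁻¹`. -/
theorem HasEDEERP.exists_EL (hC : IsMonster L κ C) (h : HasEDEERP L C) {k : ℕ}
    (a : Fin k → C) : ∃ η ∈ EL (C ≃[L] C) (enumTypes T C), ∀ p, η p ∈ homogeneousTypes T a := by
  let Z : (enumTypes T C × L.Formula (Fin k ⊕ C)) × {a' : Fin k → C // SameType L a' a} →
      Set (enumTypes T C → enumTypes T C) := fun i =>
    {η | (η i.1.1).1.Contains i.1.2 i.2.1 ↔ (η i.1.1).1.Contains i.1.2 a}
  obtain ⟨η, hη, hZ⟩ := (isClosed_EL (G := C ≃[L] C)).isCompact.inter_iInter_nonempty Z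
    (fun i => (isClosed_contains_iff i.1.2 i.2.1 a).preimage
      (continuous_apply (A := fun _ => enumTypes T C) i.1.1)) (by
      intro t
      let S : Set C := Set.range a ∪ ⋃ i ∈ t, Set.range i.2.1
      have hS : S.Finite := (Set.finite_range a).union
        (t.finite_toSet.biUnion fun i _ => Set.finite_range _)
      obtain ⟨σ, hσ⟩ := h.exists_equiv hC a hS Set.subset_union_left
        (fun i : Fin t.card => (t.equivFin.symm i).1.1.2)
        (fun i => (t.equivFin.symm i).1.1.1.1)
      refine ⟨_, smul_mem_EL σ⁻¹, Set.mem_iInter₂.2 fun i hi => ?_⟩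
      have := hσ i.2.1 ⟨fun j => Or.inr (Set.mem_biUnion hi ⟨j, rfl⟩), i.2.2⟩
        (t.equivFin ⟨i, hi⟩)
      rw [Equiv.symm_apply_apply] at this
      exact (contains_smul_inv σ i.1.1 i.1.2 _).trans
        (this.trans (contains_smul_inv σ i.1.1 i.1.2 _).symm))
  refine ⟨η, hη, fun p φ a' ha' => ?_⟩
  exact Set.mem_iInter.1 hZ ⟨⟨p, φ⟩, ⟨a', ha'⟩⟩

/-- The maps into the closed invariant set `homogeneousTypes T a` form a two-sided ideal, which
contains M. Homogeneity for every `a` is invariance, because `σ⁻¹ ∘ a` realizes tp(a). -/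
theorem HasEDEERP.smul_eq (hC : IsMonster L κ C) (h : HasEDEERP L C)
    (M : MinimalLeftIdeal (C ≃[L] C) (enumTypes T C)) {η : enumTypes T C → enumTypes T C}
    (hη : η ∈ M.carrier) (σ : C ≃[L] C) (p : enumTypes T C) : σ • η p = η p := by
  have key : ∀ {k : ℕ} (a : Fin k → C), η p ∈ homogeneousTypes T a := by
    intro k a
    have := M.subset_of_twoSided
      {η ∈ EL (C ≃[L] C) (enumTypes T C) | ∀ p, η p ∈ homogeneousTypes T a}
      (h.exists_EL hC a) (fun η hη => hη.1)
      (fun η hη μ hμ => ⟨comp_mem_EL hη hμ.1, fun p =>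
        EL_induction (P := {η | η (μ p) ∈ homogeneousTypes T a})
          ((isClosed_homogeneousTypes a).preimage (continuous_apply (μ p)))
          (fun σ => smul_mem_homogeneousTypes (hμ.2 p) σ) hη⟩)
      (fun η hη μ hμ => ⟨comp_mem_EL hμ.1 hη, fun p => hμ.2 (η p)⟩)
    exact (this hη).2 p
  refine Subtype.ext (GlobalType.ext fun k φ a => ?_)
  refine (GlobalType.contains_smul σ (η p).1 φ a).trans (key a φ _ ?_)
  exact sameType_comp_equiv σ⁻¹ fun _ => Iff.rfl

theorem HasEDEERP.minimalLeftIdeal_eq_singleton (hC : IsMonster L κ C) (h : HasEDEERP L C)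
    (M : MinimalLeftIdeal (C ≃[L] C) (enumTypes T C)) : ∃ η, M.carrier = {η} := by
  obtain ⟨η, hη⟩ := M.isLeftIdeal.1
  refine ⟨η, ?_⟩
  rw [← M.image_comp_eq hη]
  refine Set.Subset.antisymm ?_ ?_
  · rintro _ ⟨θ, hθ, rfl⟩
    funext p
    exact EL_induction (P := {θ | θ (η p) = η p})
      (isClosed_eq (continuous_apply (η p)) continuous_const)
      (fun σ => h.smul_eq hC M hη σ p) hθ
  · rintro _ rfl
    exact ⟨id, id_mem_EL, rfl⟩

theorem subsingleton_ellisGroup_of_eq_singleton {G X : Type*} [Group G] [MulAction G X]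
    [TopologicalSpace X] {M : MinimalLeftIdeal G X} (hM : ∃ η, M.carrier = {η})
    (u : M.Idempotent) : Subsingleton (EllisGroup M u) := by
  obtain ⟨η, hη⟩ := hM
  refine ⟨fun x y => EllisGroup.ext ?_⟩
  exact (hη.subset x.val_mem).trans (hη.subset y.val_mem).symm

theorem HasEDEERP.exists_invariant_type (hC : IsMonster L κ C) (h : HasEDEERP L C)
    (T : L.Theory) [C ⊨ T] : ∃ p : enumTypes T C, ∀ σ : C ≃[L] C, σ • p = p := by
  obtain ⟨M⟩ := exists_minimalLeftIdeal (C ≃[L] C) (enumTypes T C)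
  obtain ⟨η, hη⟩ := M.isLeftIdeal.1
  obtain ⟨p⟩ := nonempty_enumTypes T C
  exact ⟨η p, fun σ => h.smul_eq hC M hη σ p⟩

end Ramsey

/-! ### An invariant type trivializes the Galois groups. -/

section Galois

variable {L : FirstOrder.Language.{u, v}} {κ : Cardinal.{w}} {T : L.Theory} {C : Type w}
  [L.Structure C] [Nonempty C] [C ⊨ T]

/-- An automorphism-invariant global type forces all bounded invariant equivalence relations to
be coarser than equality of types. -/
theorem rel_of_invariant_type (hC : IsMonster L κ C) {p : enumTypes T C}
    (hp : ∀ σ : C ≃[L] C, σ • p = p) {α : Type w} (hα : #α < κ) {E : Setoid (α → C)}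
    (hinv : IsInvariant L E) (hbdd : IsBounded κ E) (a : α → C) (τ : C ≃[L] C) :
    E a (τ ∘ a) := by
  obtain ⟨K, _, f, d, _, hf, hinst, hext⟩ := p.1.exists_realization
  have hd1 : ∀ θ : L.Formula C, θ.Realize (id : C → C) → θ.Realize d := fun θ hθ =>
    (hext θ).1 (p.2 _ ((Theory.CompleteType.formula_mem_typeOf (T := T)).2 hθ))
  have hd : SameTypeIn L (id : C → C) d := fun θ => ⟨hd1 θ, fun hθ => by
    by_contra hcon
    exact Formula.realize_not.1 (hd1 θ.not (Formula.realize_not.2 hcon)) hθ⟩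
  have hρ : ∀ ρ : C ≃[L] C, SameTypeIn L (Sum.elim (f ∘ ρ) d) (Sum.elim f d) := by
    intro ρ θ
    have h1 := GlobalType.instanceSentence_mem_smul ρ⁻¹ p.1 θ
    have h2 : ρ⁻¹ • p.1 = p.1 := congrArg Subtype.val (hp ρ⁻¹)
    rw [h2, inv_inv, hinst, hinst, Formula.realize_relabel, Sum.elim_comp_map] at h1
    exact h1.symm
  classical
  -- One realization of tp(a) from each class that has one; other classes get a dummy. Boundedness
  -- of E makes the whole family small.
  let rep : Quotient E → α → C := fun q =>
    if h : ∃ x, Quotient.mk E x = q ∧ SameTypeIn L x a then h.choose else a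
  let c : (Quotient E × α) ⊕ (α ⊕ α) → C :=
    Sum.elim (fun x => rep x.1 x.2) (Sum.elim a (τ ∘ a))
  have hαα : #(α ⊕ α) < κ := by
    rw [mk_sum, lift_id]
    exact add_lt_of_lt hC.aleph0_lt.le hα hα
  have hι : #((Quotient E × α) ⊕ (α ⊕ α)) < κ := by
    rw [mk_sum, lift_id, lift_id, mk_prod, lift_id, lift_id]
    exact add_lt_of_lt hC.aleph0_lt.le (mul_lt_of_lt hC.aleph0_lt.le hbdd hα) hαα
  obtain ⟨a', ha'⟩ := hC.exists_copy (f := f) hf hι hα c (d ∘ a)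
  have haa' : SameTypeIn L a' a := (ha'.comp Sum.inr).trans (hd.comp a).symm
  have hrep : Quotient.mk E (rep (Quotient.mk E a')) = Quotient.mk E a' ∧
      SameTypeIn L (rep (Quotient.mk E a')) a := by
    have h : ∃ x, Quotient.mk E x = Quotient.mk E a' ∧ SameTypeIn L x a := ⟨a', rfl, haa'⟩
    simp only [rep, dif_pos h]
    exact h.choose_spec
  -- By invariance of `p`, all realizations of tp(a) inside `c` stand in the same relation to `a'`,
  -- which imitates `d ∘ a` over `c`.
  have hpair : ∀ g : α → (Quotient E × α) ⊕ (α ⊕ α), SameTypeIn L (c ∘ g) a →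
      SameTypeIn L (Sum.elim (c ∘ g) a') (Sum.elim (f ∘ a) (d ∘ a)) := by
    intro g hg
    have h1 := ha'.comp (Sum.map g id)
    rw [Sum.elim_comp_map, Sum.elim_comp_map] at h1
    refine h1.trans ?_
    obtain ⟨ρ, h2⟩ := hC.exists_equiv hα hg.symm
    have h3 := (hρ ρ).comp (Sum.map a a)
    rw [Sum.elim_comp_map, Sum.elim_comp_map, Function.comp_assoc f ρ a, h2] at h3
    exact h3
  -- The representative of the class of `a'` is E-related to `a'`. An automorphism fixing `a'`
  -- carries it to any other realization inside `c`, in particular to `a` and `τ ∘ a`.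
  have hE : ∀ g : α → (Quotient E × α) ⊕ (α ⊕ α), SameTypeIn L (c ∘ g) a → E (c ∘ g) a' := by
    intro g hg
    have h0 := hpair (fun i => Sum.inl (Quotient.mk E a', i)) hrep.2
    obtain ⟨ρ, h2⟩ := hC.exists_equiv hαα (h0.trans (hpair g hg).symm)
    have h3 := hinv ρ _ _ (Quotient.exact hrep.1)
    have h4 : ρ ∘ rep (Quotient.mk E a') = c ∘ g := funext fun i => congrFun h2 (Sum.inl i)
    have h5 : ρ ∘ a' = a' := funext fun i => congrFun h2 (Sum.inr i)
    rwa [h4, h5] at h3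
  exact E.trans (hE (fun i => Sum.inr (Sum.inl i)) fun _ => Iff.rfl)
    (E.symm (hE (fun i => Sum.inr (Sum.inr i)) (sameTypeIn_comp_equiv τ a)))

theorem HasEDEERP.subsingleton_galois (hC : IsMonster L κ C) (h : HasEDEERP L C)
    (T : L.Theory) [C ⊨ T] : Subsingleton (GalL L C κ) ∧ Subsingleton (GalKP L C κ) := by
  obtain ⟨p, hp⟩ := h.exists_invariant_type hC T
  have hL : autfL L C κ = ⊤ := by
    refine (Subgroup.eq_top_iff' _).2 fun τ α hα a => ?_
    exact Setoid.sInf_iff.2 fun E hE => rel_of_invariant_type hC hp hα hE.1 hE.2 a τ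
  have hKP : autfKP L C κ = ⊤ := by
    refine (Subgroup.eq_top_iff' _).2 fun τ α hα a => ?_
    exact Setoid.sInf_iff.2 fun E hE =>
      rel_of_invariant_type hC hp hα hE.1.isInvariant hE.2 a τ
  exact ⟨QuotientGroup.subsingleton_iff.2 hL, QuotientGroup.subsingleton_iff.2 hKP⟩

end Galois

/-! ### Finite Ramsey degrees and profiniteness. -/

section RamseyDegree

open EllisDynamics

variable {L : FirstOrder.Language.{u, v}} {κ : Cardinal.{w}} {T : L.Theory} {C : Type w}
  [L.Structure C] [Nonempty C] [C ⊨ T]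

/-- The set of all realizations `a'` of `tp(a)` with `φ(a', y)` in a given type. -/
noncomputable def traceMap (T : L.Theory) [C ⊨ T] {k : ℕ} (a : Fin k → C)
    (φ : L.Formula (Fin k ⊕ C)) (p : enumTypes T C) : {a' : Fin k → C // SameType L a' a} → Bool :=
  fun a' => @decide (p.1.Contains φ a'.1) (Classical.propDecidable _)

theorem traceMap_eq_iff {k : ℕ} {a : Fin k → C} {φ : L.Formula (Fin k ⊕ C)}
    {p q : enumTypes T C} {a' a'' : {a' : Fin k → C // SameType L a' a}} :
    traceMap T a φ p a' = traceMap T a φ q a'' ↔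
      (p.1.Contains φ a'.1 ↔ q.1.Contains φ a''.1) :=
  @decide_eq_decide _ _ (Classical.propDecidable _) (Classical.propDecidable _)

theorem continuous_traceMap {k : ℕ} (a : Fin k → C) (φ : L.Formula (Fin k ⊕ C)) :
    Continuous (traceMap T a φ) := by
  refine continuous_pi fun a' => (continuous_bool_rng true).2 ?_
  convert isClopen_enumTypes_contains T C φ a'.1 using 1
  ext p
  exact @decide_eq_true_iff _ (Classical.propDecidable _)

theorem traceMap_smul {k : ℕ} {a : Fin k → C} {φ : L.Formula (Fin k ⊕ C)} (σ : C ≃[L] C)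
    {p q : enumTypes T C} (h : traceMap T a φ p = traceMap T a φ q) :
    traceMap T a φ (σ • p) = traceMap T a φ (σ • q) := by
  funext a'
  have h1 := traceMap_eq_iff.1 (congrFun h ⟨_, sameType_comp_equiv σ⁻¹ a'.2⟩)
  have hp := GlobalType.contains_smul σ p.1 φ a'.1
  have hq := GlobalType.contains_smul σ q.1 φ a'.1
  exact traceMap_eq_iff.2 (hp.trans (h1.trans hq.symm))

theorem contains_iff_of_traceMap_eq {k : ℕ} {a : Fin k → C} {φ : L.Formula (Fin k ⊕ C)}
    {p q : enumTypes T C} (h : traceMap T a φ p = traceMap T a φ q) :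
    p.1.Contains φ a ↔ q.1.Contains φ a := by
  have h1 := traceMap_eq_iff.1 (congrFun h ⟨a, fun _ => Iff.rfl⟩)
  exact h1

/-- This encodes that at most `l` functions `p ↦ [φ(a', y) ∈ η p]` occur. The types `p i j` are
candidate witnesses separating `x i` from `x j`; with them each condition involves finitely many
values of `η` and is closed. -/
theorem HasSepFinEDEERdeg.exists_EL (hC : IsMonster L κ C) (h : HasSepFinEDEERdeg C T) {k : ℕ}
    (a : Fin k → C) (φ : L.Formula (Fin k ⊕ C)) :
    ∃ l : ℕ, ∃ η ∈ EL (C ≃[L] C) (enumTypes T C),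
      ∀ (x : Fin (l + 1) → {a' : Fin k → C // SameType L a' a})
        (p : Fin (l + 1) → Fin (l + 1) → enumTypes T C), ∃ i j, i ≠ j ∧
          ((η (p i j)).1.Contains φ (x i).1 ↔ (η (p i j)).1.Contains φ (x j).1) := by
  obtain ⟨l, hl⟩ := h.exists_equiv hC a φ
  let I := (Fin (l + 1) → {a' : Fin k → C // SameType L a' a}) ×
    (Fin (l + 1) → Fin (l + 1) → enumTypes T C)
  let Z : I → Set (enumTypes T C → enumTypes T C) := fun s => ⋃ ij : Fin (l + 1) × Fin (l + 1),
    {η | ij.1 ≠ ij.2 ∧ ((η (s.2 ij.1 ij.2)).1.Contains φ (s.1 ij.1).1 ↔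
      (η (s.2 ij.1 ij.2)).1.Contains φ (s.1 ij.2).1)}
  have hZ : ∀ s, IsClosed (Z s) := fun s => isClosed_iUnion_of_finite fun ij =>
    isClosed_const.and ((isClosed_contains_iff φ (s.1 ij.1).1 (s.1 ij.2).1).preimage
      (continuous_apply (A := fun _ => enumTypes T C) (s.2 ij.1 ij.2)))
  obtain ⟨η, hη, hηZ⟩ := (isClosed_EL (G := C ≃[L] C)).isCompact.inter_iInter_nonempty Z hZ (by
    intro t
    let S : Set C := Set.range a ∪ ⋃ s ∈ t, ⋃ i, Set.range (s.1 i).1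
    have hS : S.Finite := (Set.finite_range a).union
      (t.finite_toSet.biUnion fun s _ => Set.finite_iUnion fun i => Set.finite_range _)
    let P : Set (enumTypes T C) := ⋃ s ∈ t, ⋃ i, Set.range (s.2 i)
    have hP : P.Finite :=
      t.finite_toSet.biUnion fun s _ => Set.finite_iUnion fun i => Set.finite_range _
    obtain ⟨n, p, hp⟩ := hP.fin_embedding
    obtain ⟨σ, hσ⟩ := hl S hS Set.subset_union_left n p
    refine ⟨_, smul_mem_EL σ⁻¹, Set.mem_iInter₂.2 fun s hs => ?_⟩
    let V : Fin (l + 1) → Fin n → Prop := fun i j => (p j).1.Contains φ (σ ∘ (s.1 i).1)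
    -- Pigeonhole: the `l + 1` tuples lie in S, where at most `l` patterns occur.
    have hV : ¬ Function.Injective V := by
      intro hinj
      have h1 : (Set.range V).encard ≤ l := by
        refine le_trans (Set.encard_le_encard ?_) hσ
        rintro _ ⟨i, rfl⟩
        refine ⟨(s.1 i).1, ⟨fun j => Or.inr ?_, (s.1 i).2⟩, rfl⟩
        exact Set.mem_biUnion hs (Set.mem_iUnion.2 ⟨i, j, rfl⟩)
      have h2 := hinj.encard_range.trans h1
      rw [ENat.card_eq_coe_fintype_card, Fintype.card_fin] at h2
      exact absurd (Nat.cast_le.1 h2) (Nat.not_succ_le_self l)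
    obtain ⟨i, j, hij, hne⟩ : ∃ i j, V i = V j ∧ i ≠ j := by
      simpa [Function.Injective] using hV
    refine Set.mem_iUnion.2 ⟨(i, j), hne, ?_⟩
    obtain ⟨m, hm⟩ : s.2 i j ∈ Set.range p :=
      hp ▸ Set.mem_biUnion hs (Set.mem_iUnion.2 ⟨i, j, rfl⟩)
    have h1 := iff_of_eq (congrFun hij m)
    simp only [V, hm] at h1
    exact (contains_smul_inv σ _ φ _).trans (h1.trans (contains_smul_inv σ _ φ _).symm))
  refine ⟨l, η, hη, fun x p => ?_⟩
  obtain ⟨ij, h1, h2⟩ := Set.mem_iUnion.1 (Set.mem_iInter.1 hηZ (x, p))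
  exact ⟨ij.1, ij.2, h1, h2⟩

/-- Read [φ(a', y) ∈ η p] as a matrix with rows `a'` and columns `p`. Among `l + 1` distinct rows
each pair would be separated by some column, against `exists_EL`; and a 0-1 matrix with finitely
many distinct rows has finitely many distinct columns. -/
theorem HasSepFinEDEERdeg.exists_finite_range (hC : IsMonster L κ C)
    (h : HasSepFinEDEERdeg C T) {k : ℕ} (a : Fin k → C) (φ : L.Formula (Fin k ⊕ C)) :
    ∃ η ∈ EL (C ≃[L] C) (enumTypes T C), (Set.range (traceMap T a φ ∘ η)).Finite := by
  obtain ⟨l, η, hη, hl⟩ := h.exists_EL hC a φ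
  refine ⟨η, hη, ?_⟩
  let W : {a' : Fin k → C // SameType L a' a} → enumTypes T C → Bool :=
    fun a' p => traceMap T a φ (η p) a'
  have hW : (Set.range W).Finite := by
    by_contra hinf
    let e := Set.Infinite.natEmbedding _ hinf
    choose x hx using fun i : Fin (l + 1) => (e i).2
    have hp : ∀ i j : Fin (l + 1), ∃ p, i ≠ j → W (x i) p ≠ W (x j) p := by
      intro i j
      by_cases hij : i = j
      · exact ⟨(nonempty_enumTypes T C).some, fun h => absurd hij h⟩
      · have hne : W (x i) ≠ W (x j) := by
          rw [hx, hx]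
          exact fun h => hij (Fin.ext (e.injective (Subtype.ext h)))
        obtain ⟨p, hp⟩ := Function.ne_iff.1 hne
        exact ⟨p, fun _ => hp⟩
    choose p hp using hp
    obtain ⟨i, j, hij, hiff⟩ := hl x p
    exact hp i j hij (traceMap_eq_iff.2 hiff)
  have := hW.to_subtype
  refine (Set.finite_range fun (g : Set.range W → Bool) a' => g ⟨W a', a', rfl⟩).subset ?_
  rintro _ ⟨p, rfl⟩
  exact ⟨fun y => y.1 p, rfl⟩

theorem HasSepFinEDEERdeg.isProfinite_ellisGroup (hC : IsMonster L κ C)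
    (h : HasSepFinEDEERdeg C T) (M : MinimalLeftIdeal (C ≃[L] C) (enumTypes T C))
    (u : M.Idempotent) : IsProfinite (EllisGroup M u) :=
  EllisDynamics.isProfinite_ellisGroup
    (ι := Σ k : ℕ, (Fin k → C) × L.Formula (Fin k ⊕ C))
    (r := fun i => traceMap T i.2.1 i.2.2)
    (fun i => continuous_traceMap i.2.1 i.2.2)
    (fun _ σ _ _ => traceMap_smul σ)
    (fun _ _ hpq => Subtype.ext (GlobalType.ext fun k φ a =>
      contains_iff_of_traceMap_eq (hpq ⟨k, a, φ⟩)))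
    (fun i => h.exists_finite_range hC i.2.1 i.2.2)

end RamseyDegree

end MonsterModel

theorem mainTheorem2 {L : FirstOrder.Language.{u, v}} (T : L.Theory) (hT : T.IsComplete)
    (κ : Cardinal.{w}) (C : Type w) [L.Structure C] [Nonempty C] [C ⊨ T]
    (hC : MonsterModel.IsMonster L κ C) :
    (MonsterModel.HasEDEERP L C →
      (∀ M : EllisDynamics.MinimalLeftIdeal (C ≃[L] C) (MonsterModel.enumTypes T C),
        (∃ η, M.carrier = {η}) ∧
          ∀ u : M.Idempotent, Subsingleton (EllisDynamics.EllisGroup M u)) ∧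
      Subsingleton (MonsterModel.GalL L C κ) ∧ Subsingleton (MonsterModel.GalKP L C κ)) ∧
    (MonsterModel.HasSepFinEDEERdeg C T →
      ∀ (M : EllisDynamics.MinimalLeftIdeal (C ≃[L] C) (MonsterModel.enumTypes T C))
        (u : M.Idempotent), EllisDynamics.IsProfinite (EllisDynamics.EllisGroup M u)) := by
  refine ⟨fun h => ⟨fun M => ?_, h.subsingleton_galois hC T⟩,
    fun h M u => h.isProfinite_ellisGroup hC M u⟩
  have hM := h.minimalLeftIdeal_eq_singleton hC M
  exact ⟨hM, fun u => MonsterModel.subsingleton_ellisGroup_of_eq_singleton hM u⟩
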